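/- Let $n\ge 1$, let $M$ be a closed oriented smooth manifold of dimension $2n$, and let $\pi:F\to M$ be an oriented real vector bundle of rank $2n$ with a flat connection $\nabla^F$ and total space $\mathcal F$. Let $(U_\alpha,(x^i_\alpha))$, $\alpha=1,\dots,N$, be positively oriented coordinate charts covering $M$ such that, over each $U_\alpha$, parallel transport gives an identification $F|_{U_\alpha}\simeq U_\alpha\times\mathbf R^{2n}$ by positively oriented parallel frames, with fibre coordinates $(y^k_\alpha)_{1\le k\le 2n}$. The order of the indices is part of the data. On $F|_{U_\alpha}$ put $$d^H=\sum_i dx^i_\alpha\,\frac{\partial}{\partial x^i_\alpha},\qquad d^V=\sum_i dy^i_\alpha\,\frac{\partial}{\partial y^i_\alpha};$$ these operators do not depend on $\alpha$. Assume that the covering is transversal: each $U_\alpha$ has a smooth boundary, and the boundaries $\partial U_\alpha$ meet completely transversally (at every point, the conormals of the boundaries through this point are linearly independent). Let $g^{TM}$ be a Riemannian metric on $M$ and let $r_\alpha$ be the normal geodesic coordinate near $\partial U_\alpha$ (the signed distance to $\partial U_\alpha$, positive inside $U_\alpha$). Let $\rho_\alpha\in C^\infty(M)$ satisfy $\operatorname{Supp}\rho_\alpha\subseteq\overline{U}_\alpha$,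 $\rho_\alpha>0$ on $U_\alpha$, and $\rho_\alpha=\exp(-1/r_\alpha^2)$ on the part of $U_\alpha$ near $\partial U_\alpha$. For $T>0$ define the function $$|Y|^2_{T}=\sum_{\alpha=1}^N\rho_\alpha T^\alpha\sum_{k=1}^{2n}(y^k_\alpha)^2$$ on $\mathcal F$ (functions on $M$ are lifted to $\mathcal F$ by $\pi$). Let $\mathbf B\subset M$ be the set of points that lie on exactly $2n$ of the boundaries $\partial U_\beta$, and let $\mathbf B_+$ be the set of those $p\in\mathbf B$ for which every index $\beta$ with $p\in\partial U_\beta$ is larger than every index $\alpha$ with $p\in U_\alpha$. Then for every $p\in M\setminus\mathbf B_+$ there is an open neighborhood $V_p$ of $p$ in $M$ such that, for every $f\in C^\infty(M)$ supported in $V_p$, the component of degree $4n$ of $f\exp\left(\frac12 d^Hd^V|Y|^2_{T}-|Y|^2_{T}\right)$ is absolutely integrable over $\mathcal F$ for every $T>0$, and $$\lim_{T\to+\infty}\int_{\mathcal F} f\,\exp\left(\tfrac12\, d^Hd^V|Y|^2_{T}-|Y|^2_{T}\right)=0,$$ where the integral of an inhomogeneous form is that of its component of degree $4n$. -/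

import Mathlib

open Bundle Filter Topology MeasureTheory
open scoped Manifold ContDiff

namespace FlatCover

/-- The model space `ℝ^{2n}`, both for the base manifold and for the fibres of the bundle. -/
abbrev Model (n : ℕ) : Type := EuclideanSpace ℝ (Fin (2 * n))

/-! ### Differential forms in coordinates `(x, y) ∈ ℝ^{2n} × ℝ^{2n}` -/

section Forms

variable {n k l : ℕ}

/-- The horizontal exterior differential `d^H = ∑ᵢ dxⁱ ∂/∂xⁱ`, acting on `k`-forms: as
`extDeriv`, but only derivatives in the directions of the first factor are used. -/
noncomputable def dH (η : Model n × Model n → (Model n × Model n) [⋀^Fin k]→L[ℝ] ℝ)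
    (z : Model n × Model n) : (Model n × Model n) [⋀^Fin (k + 1)]→L[ℝ] ℝ :=
  .alternatizeUncurryFin ((fderiv ℝ η z).comp
    ((ContinuousLinearMap.inl ℝ (Model n) (Model n)).comp
      (ContinuousLinearMap.fst ℝ (Model n) (Model n))))

/-- The vertical exterior differential `d^V = ∑ᵢ dyⁱ ∂/∂yⁱ`, acting on `k`-forms. -/
noncomputable def dV (η : Model n × Model n → (Model n × Model n) [⋀^Fin k]→L[ℝ] ℝ)
    (z : Model n × Model n) : (Model n × Model n) [⋀^Fin (k + 1)]→L[ℝ] ℝ :=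
  .alternatizeUncurryFin ((fderiv ℝ η z).comp
    ((ContinuousLinearMap.inr ℝ (Model n) (Model n)).comp
      (ContinuousLinearMap.snd ℝ (Model n) (Model n))))

/-- A function, regarded as a `0`-form. -/
noncomputable def zeroForm (G : Model n × Model n → ℝ) (z : Model n × Model n) :
    (Model n × Model n) [⋀^Fin 0]→L[ℝ] ℝ :=
  ContinuousAlternatingMap.constOfIsEmpty ℝ (Model n × Model n) (Fin 0) (G z)

/-- The exterior product of alternating forms (a signed sum over shuffles). -/
noncomputable def wedge {W : Type*} [AddCommGroup W] [Module ℝ W]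
    (a : W [⋀^Fin k]→ₗ[ℝ] ℝ) (b : W [⋀^Fin l]→ₗ[ℝ] ℝ) : W [⋀^Fin (k + l)]→ₗ[ℝ] ℝ :=
  ((LinearMap.mul' ℝ ℝ).compAlternatingMap (a.domCoprod b)).domDomCongr finSumFinEquiv

/-- The `j`-th exterior power `Ω ∧ ⋯ ∧ Ω` of a `2`-form. -/
noncomputable def wedgePow {W : Type*} [AddCommGroup W] [Module ℝ W]
    (Ω : W [⋀^Fin 2]→ₗ[ℝ] ℝ) : (j : ℕ) → W [⋀^Fin (2 * j)]→ₗ[ℝ] ℝ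
  | 0 => AlternatingMap.constOfIsEmpty ℝ W (Fin 0) 1
  | j + 1 => wedge (wedgePow Ω j) Ω

/-- The component of degree `2j` of the inhomogeneous form
`exp (Ω - s) = e^{-s} ∑ⱼ Ω^j / j!`, for a `2`-form `Ω` and a scalar `s`. -/
noncomputable def expForm {W : Type*} [AddCommGroup W] [Module ℝ W]
    (Ω : W [⋀^Fin 2]→ₗ[ℝ] ℝ) (s : ℝ) (j : ℕ) : W [⋀^Fin (2 * j)]→ₗ[ℝ] ℝ :=
  (Real.exp (-s) * ((j.factorial : ℝ))⁻¹) • wedgePow Ω j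

/-- The standard oriented frame `∂/∂x¹, …, ∂/∂x^{2n}, ∂/∂y¹, …, ∂/∂y^{2n}`. -/
noncomputable def stdFrame (n : ℕ) (i : Fin (2 * (2 * n))) : Model n × Model n :=
  if h : (i : ℕ) < 2 * n then (EuclideanSpace.single ⟨i, h⟩ 1, 0)
  else (0, EuclideanSpace.single ⟨(i : ℕ) - 2 * n, by have := i.isLt; omega⟩ 1)

end Forms

/-! ### Integration of top degree forms over an oriented manifold with a finite oriented atlas -/

section Integration

variable {n N : ℕ} {X : Type*} [TopologicalSpace X]

/-- In the coordinates `Φ α`, the part of the chart domain that is not covered by the earlier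
charts.  These parts correspond to a partition of `X` into Borel sets if the charts cover `X`. -/
def piece (Φ : Fin N → OpenPartialHomeomorph X (Model n × Model n)) (α : Fin N) :
    Set (Model n × Model n) :=
  {z | z ∈ (Φ α).target ∧ ∀ β < α, (Φ α).symm z ∉ (Φ β).source}

/-- A form of degree `4n` on `X`, given by its expressions `η α` in the charts `Φ α`, is
absolutely integrable. -/
def FormIntegrable (Φ : Fin N → OpenPartialHomeomorph X (Model n × Model n))
    (η : Fin N → Model n × Model n → (Model n × Model n) [⋀^Fin (2 * (2 * n))]→ₗ[ℝ] ℝ) : Prop :=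
  ∀ α, IntegrableOn (fun z => η α z (stdFrame n)) (piece Φ α)

/-- The integral over `X` of a form of degree `4n`, given by its expressions `η α` in the charts
`Φ α` of an oriented atlas: `X` is cut into Borel pieces, each inside one chart domain. -/
noncomputable def formIntegral (Φ : Fin N → OpenPartialHomeomorph X (Model n × Model n))
    (η : Fin N → Model n × Model n → (Model n × Model n) [⋀^Fin (2 * (2 * n))]→ₗ[ℝ] ℝ) : ℝ :=
  ∑ α, ∫ z in piece Φ α, η α z (stdFrame n)

end Integration

/-! ### Flat bundles and transversal coverings -/

section Geometry

variable {n N : ℕ} {M : Type*} [TopologicalSpace M] [ChartedSpace (Model n) M]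

/-- `φ` is a finite family of smooth coordinate charts whose domains cover `M` and which are
positively oriented (for one orientation of `M`): the Jacobians of the transition maps are
positive. -/
structure IsOrientedAtlas (φ : Fin N → OpenPartialHomeomorph M (Model n)) : Prop where
  smooth : ∀ α, φ α ∈ IsManifold.maximalAtlas (𝓡 (2 * n)) ∞ M
  covers : ∀ x : M, ∃ α, x ∈ (φ α).source
  pos : ∀ α β, ∀ x ∈ (φ α).source, x ∈ (φ β).source →
    0 < (fderiv ℝ (φ β ∘ (φ α).symm) (φ α x)).det

section Bundle

variable {F : M → Type*} [TopologicalSpace (TotalSpace (Model n) F)]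
  [∀ x, AddCommGroup (F x)] [∀ x, Module ℝ (F x)] [∀ x, TopologicalSpace (F x)]
  [∀ x, IsTopologicalAddGroup (F x)] [∀ x, ContinuousSMul ℝ (F x)]
  [FiberBundle (Model n) F]

/-- `e` is a family of identifications `F|_{U α} ≃ U α × ℝ^{2n}` (`U α` being the domain of the
chart `φ α`) by `∇`-parallel smooth frames, positively oriented (for one orientation of `F`).
As the `U α` cover `M`, the existence of such a family means that `∇` is flat and `F` oriented. -/
structure IsFlatTrivialization (nabla : CovariantDerivative (𝓡 (2 * n)) (Model n) F)
    (φ : Fin N → OpenPartialHomeomorph M (Model n))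
    (e : Fin N → Trivialization (Model n) (TotalSpace.proj : TotalSpace (Model n) F → M))
    [∀ α, (e α).IsLinear ℝ] : Prop where
  baseSet_eq : ∀ α, (e α).baseSet = (φ α).source
  smooth : ∀ α (w : Model n), ContMDiffOn (𝓡 (2 * n)) ((𝓡 (2 * n)).prod 𝓘(ℝ, Model n)) ∞
    (fun x => TotalSpace.mk' (Model n) x ((e α).symm x w)) (φ α).source
  parallel : ∀ α (w : Model n), ∀ x ∈ (φ α).source, nabla (fun x' => (e α).symm x' w) x = 0
  pos : ∀ α β, ∀ x ∈ (φ α).source, x ∈ (φ β).source →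
    0 < LinearMap.det ((e α).coordChangeL ℝ (e β) x : Model n →ₗ[ℝ] Model n)

/-- The coordinates `(x_α, y_α)` on the part of the total space that lies over `U α`. -/
noncomputable def totalChart (φ : Fin N → OpenPartialHomeomorph M (Model n))
    (e : Fin N → Trivialization (Model n) (TotalSpace.proj : TotalSpace (Model n) F → M))
    (α : Fin N) : OpenPartialHomeomorph (TotalSpace (Model n) F) (Model n × Model n) :=
  (e α).toOpenPartialHomeomorph.trans ((φ α).prod (OpenPartialHomeomorph.refl (Model n)))

/-- The function `|Y|²_T = ∑_α ρ_α T^α ∑_k (y_α^k)²` on the total space.  The indices of the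
covering run through `1, …, N`, so that the exponent for `α : Fin N` is `α + 1`. -/
noncomputable def normSqY
    (e : Fin N → Trivialization (Model n) (TotalSpace.proj : TotalSpace (Model n) F → M))
    (ρ : Fin N → M → ℝ) (T : ℝ) (v : TotalSpace (Model n) F) : ℝ :=
  ∑ α, ρ α v.proj * T ^ ((α : ℕ) + 1) * ∑ k, ((e α v).2 k) ^ 2

/-- The component of degree `4n` of `f · exp (½ d^H d^V |Y|²_T - |Y|²_T)` in the coordinates
`(x_α, y_α)`. -/
noncomputable def eulerForm (φ : Fin N → OpenPartialHomeomorph M (Model n))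
    (e : Fin N → Trivialization (Model n) (TotalSpace.proj : TotalSpace (Model n) F → M))
    (ρ : Fin N → M → ℝ) (f : M → ℝ) (T : ℝ) (α : Fin N) (z : Model n × Model n) :
    (Model n × Model n) [⋀^Fin (2 * (2 * n))]→ₗ[ℝ] ℝ :=
  let G : Model n × Model n → ℝ := fun z' => normSqY e ρ T ((totalChart φ e α).symm z')
  f ((totalChart φ e α).symm z).proj •
    expForm ((1 / 2 : ℝ) • dH (dV (zeroForm G)) z).toAlternatingMap (G z) (2 * n)

end Bundle

/-- `u` is a smooth function near `p`, vanishing at `p` with nonzero differential, such that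
`U = {u > 0}` near `p`. -/
structure IsLocalDefiningFunction (U : Set M) (p : M) (u : M → ℝ) : Prop where
  smooth : ContMDiffAt (𝓡 (2 * n)) 𝓘(ℝ, ℝ) ∞ u p
  zero : u p = 0
  deriv_ne_zero : mvfderiv (𝓡 (2 * n)) u p ≠ 0
  mem_iff : ∀ᶠ x in 𝓝 p, x ∈ U ↔ 0 < u x

/-- The sets `U α` have smooth boundaries, which intersect each other completely transversally:
at every point the conormals of the boundaries through that point are linearly independent. -/
structure IsTransversalFamily (U : Fin N → Set M) : Prop where
  smooth_boundary : ∀ α, ∀ p ∈ frontier (U α), ∃ u, IsLocalDefiningFunction (n := n) (U α) p u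
  transversal : ∀ (p : M) (u : Fin N → M → ℝ),
    (∀ α, p ∈ frontier (U α) → IsLocalDefiningFunction (n := n) (U α) p (u α)) →
    LinearIndependent ℝ (fun α : {α // p ∈ frontier (U α)} =>
      mvfderiv (𝓡 (2 * n)) (u α) p)

/-- `r` is the normal geodesic coordinate near the boundary of `U`, positive inside `U`, for the
Riemannian metric `g`: it is smooth near the boundary, vanishes on it, and its gradient is of
length one (so that `r` is the signed distance from the boundary). -/
def IsNormalGeodesicCoordinate
    [IsManifold (𝓡 (2 * n)) ∞ M]
    (g : ContMDiffRiemannianMetric (𝓡 (2 * n)) ∞ (Model n)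
      (fun x : M => TangentSpace (𝓡 (2 * n)) x))
    (U : Set M) (r : M → ℝ) : Prop :=
  ∃ O : Set M, IsOpen O ∧ frontier U ⊆ O ∧ ContMDiffOn (𝓡 (2 * n)) 𝓘(ℝ, ℝ) ∞ r O ∧
    (∀ x ∈ frontier U, r x = 0) ∧ (∀ x ∈ O, x ∈ U ↔ 0 < r x) ∧
    ∀ x ∈ O, ∃ ν : TangentSpace (𝓡 (2 * n)) x, g.inner x ν ν = 1 ∧
      ∀ w : TangentSpace (𝓡 (2 * n)) x, mvfderiv (𝓡 (2 * n)) r x w = g.inner x ν w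

/-- `ρ` is a smooth function on `M`, supported in the closure of `U`, positive on `U`, and equal
to `exp (-1 / r²)` on the inner side of the boundary of `U` near that boundary. -/
structure IsWeight (U : Set M) (r ρ : M → ℝ) : Prop where
  smooth : ContMDiff (𝓡 (2 * n)) 𝓘(ℝ, ℝ) ∞ ρ
  tsupport_subset : tsupport ρ ⊆ closure U
  pos : ∀ x ∈ U, 0 < ρ x
  eq_near : ∀ᶠ x in 𝓝ˢ (frontier U), x ∈ U → ρ x = Real.exp (-1 / r x ^ 2)

end Geometry

/-- The set `B` of points that lie on `d` different boundaries. -/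
def vertices {N : ℕ} {M : Type*} [TopologicalSpace M] (d : ℕ) (U : Fin N → Set M) : Set M :=
  {p | {α | p ∈ frontier (U α)}.ncard = d}

/-- The set `B₊` of those points of `B` for which the index of each of the `U β` with `p ∈ ∂U β`
is larger than the index of each of the `U α` that contain `p`. -/
def positiveVertices {N : ℕ} {M : Type*} [TopologicalSpace M] (d : ℕ) (U : Fin N → Set M) :
    Set M :=
  {p | p ∈ vertices d U ∧ ∀ α β, p ∈ U α → p ∈ frontier (U β) → α < β}

end FlatCover

/-! Near `p` the transition maps between the parallel frames are constant, even up to the boundary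
of each `U γ`. In one chart around `p` this gives `|Y|²_T = ∑ q_γ(x) T^(γ+1) |L_γ y|²` with constant
`L_γ`. Up to a universal factor the form has density `det (∑ T^(γ+1) dq_γ ⊗ L_γ^* L_γ y) · exp
(-|Y|²_T)` (`expForm_apply_stdFrame`), and it is enough that its fibre integrals tend to zero
uniformly in `x`.

The cancellation: the column of the determinant belonging to a tangent vector `v` is `∑ T^(γ+1)
dq_γ(v) L_γ^* L_γ y`. If `dq_γ(v) = μ q_γ` for all `γ`, this column is a multiple of the fibre
gradient of `|Y|²_T`. Since all columns are symmetric linear maps of `y`, integration by parts makes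
the fibre integral vanish (`integral_alternating_gradient_eq_zero`). If the relation fails by a
little, the integral is small (`abs_integral_det_mixedMap_le`).

Let `a` be the largest index with `p ∈ U a`, and `J` the set of `γ > a` with `p ∈ ∂U γ`. By
transversality at most `2n` boundaries pass through `p`, so `J` has fewer than `2n` elements unless
`p ∈ B₊`. Hence some unit `v` satisfies `dq_γ(v) = μ q_γ` for `γ = a` and for all `γ ∈ J`. All other
weights above `a` vanish near `p`, so the error comes from `γ < a` and is of order `T^a`, against
`T^(a+1)` in the exponent.

The remaining columns contain `dq_γ` for `γ ∈ J`, which is not bounded by a multiple of `q_γ`. The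
profile `exp (-1/r²)` bounds it by powers of `q_γ` with exponent as close to one as desired, so the
loss is a small power of `T` and the fibre integrals are `O(T^(-1/(4n)))`
(`exists_abs_integral_det_mixedMap_le`). -/

namespace FlatCover

/-! ### Powers of two-forms and determinants -/

section FormAlgebra

variable {n k l : ℕ} {W W' : Type*} [AddCommGroup W] [Module ℝ W] [AddCommGroup W'] [Module ℝ W']

theorem wedge_compLinearMap (a : W [⋀^Fin k]→ₗ[ℝ] ℝ) (b : W [⋀^Fin l]→ₗ[ℝ] ℝ) (g : W' →ₗ[ℝ] W) :
    wedge (a.compLinearMap g) (b.compLinearMap g) = (wedge a b).compLinearMap g := by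
  ext v
  simp only [wedge, AlternatingMap.domDomCongr_apply, LinearMap.compAlternatingMap_apply,
    AlternatingMap.domCoprod_apply, AlternatingMap.compLinearMap_apply, sum_apply]
  congr 1
  refine Finset.sum_congr rfl fun σ _ => ?_
  induction σ using Quotient.inductionOn'
  rw [AlternatingMap.domCoprod.summand_mk'', AlternatingMap.domCoprod.summand_mk'']
  rfl

theorem wedgePow_compLinearMap (Ω : W [⋀^Fin 2]→ₗ[ℝ] ℝ) (g : W' →ₗ[ℝ] W) (j : ℕ) :
    wedgePow (Ω.compLinearMap g) j = (wedgePow Ω j).compLinearMap g := by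
  induction j with
  | zero => ext v; simp [wedgePow]
  | succ j ih => rw [wedgePow, wedgePow, ih, wedge_compLinearMap]

/-- The `2`-form `∑ₖ dxᵏ ∧ dyᵏ` on `ℝ^{2n} × ℝ^{2n}`. -/
noncomputable def stdTwoForm (n : ℕ) : (Model n × Model n) [⋀^Fin 2]→ₗ[ℝ] ℝ :=
  AlternatingMap.alternatizeUncurryFin
    { toFun := fun u => AlternatingMap.ofSubsingleton ℝ (Model n × Model n) ℝ (0 : Fin 1)
        (innerₗ (Model n) u.1 ∘ₗ LinearMap.snd ℝ (Model n) (Model n))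
      map_add' := fun u v => by ext w; simp
      map_smul' := fun c u => by ext w; simp }

theorem stdTwoForm_apply (u v : Model n × Model n) :
    stdTwoForm n ![u, v] = inner ℝ u.1 v.2 - inner ℝ v.1 u.2 := by
  simp [stdTwoForm, AlternatingMap.alternatizeUncurryFin_apply, Fin.sum_univ_two, sub_eq_add_neg,
    Fin.removeNth]

theorem compLinearMap_apply_of_finrank_eq [FiniteDimensional ℝ W] (η : W [⋀^Fin k]→ₗ[ℝ] ℝ)
    (hk : Module.finrank ℝ W = k) (g : W →ₗ[ℝ] W) (v : Fin k → W) :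
    η.compLinearMap g v = LinearMap.det g * η v := by
  let b := Module.finBasisOfFinrankEq ℝ W hk
  have h : ∀ w : Fin k → W, η w = η b * b.det w := fun w => by
    conv_lhs => rw [η.eq_smul_basis_det b]
    rfl
  rw [AlternatingMap.compLinearMap_apply, h v, h]
  have := b.det_comp g v
  rw [Function.comp_def] at this
  rw [this]
  ring

/-- Such a form is the pullback of `∑ dxᵏ ∧ dyᵏ` under `B × id`, so its top power is multiplied by
`det B`. The value of the standard top power need not be computed, because the limit in question is
zero. -/
theorem wedgePow_apply_stdFrame (Ω : (Model n × Model n) [⋀^Fin 2]→ₗ[ℝ] ℝ)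
    (B : Model n →ₗ[ℝ] Model n)
    (h : ∀ u v, Ω ![u, v] = inner ℝ (B u.1) v.2 - inner ℝ (B v.1) u.2) :
    wedgePow Ω (2 * n) (stdFrame n) =
      LinearMap.det B * wedgePow (stdTwoForm n) (2 * n) (stdFrame n) := by
  have hΩ : Ω = (stdTwoForm n).compLinearMap (B.prodMap LinearMap.id) := by
    ext v
    have hv : v = ![v 0, v 1] := by ext i <;> fin_cases i <;> rfl
    rw [hv, h, AlternatingMap.compLinearMap_apply]
    have : (fun i => (B.prodMap LinearMap.id) ((![v 0, v 1] : Fin 2 → _) i)) =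
        ![(B (v 0).1, (v 0).2), (B (v 1).1, (v 1).2)] := by
      funext i; fin_cases i <;> rfl
    rw [this, stdTwoForm_apply]
  rw [hΩ, wedgePow_compLinearMap, compLinearMap_apply_of_finrank_eq _ (by simp; ring),
    LinearMap.det_prodMap, LinearMap.det_id, mul_one]

end FormAlgebra

/-! ### The two-form `½ d^H d^V` of a quadratic form in the fibre variable -/

section MixedDerivative

variable {n N : ℕ}

theorem hasFDerivAt_sum_smul_normSq {x y : Model n} {c : Fin N → Model n → ℝ}
    (hc : ∀ γ, DifferentiableAt ℝ (c γ) x) (L : Fin N → Model n →L[ℝ] Model n) :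
    HasFDerivAt (fun z : Model n × Model n => ∑ γ, c γ z.1 * ‖L γ z.2‖ ^ 2)
      (∑ γ, (c γ x • ((2 : ℕ) • (innerSL ℝ (L γ y)).comp ((L γ).comp (.snd ℝ (Model n) (Model n)))) +
        ‖L γ y‖ ^ 2 • (fderiv ℝ (c γ) x).comp (.fst ℝ (Model n) (Model n)))) (x, y) := by
  refine HasFDerivAt.fun_sum fun γ _ => ?_
  have h1 : HasFDerivAt (fun z : Model n × Model n => c γ z.1)
      ((fderiv ℝ (c γ) x).comp (.fst ℝ (Model n) (Model n))) (x, y) :=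
    HasFDerivAt.comp (x, y) (hc γ).hasFDerivAt hasFDerivAt_fst
  have h2 : HasFDerivAt (fun z : Model n × Model n => L γ z.2)
      ((L γ).comp (.snd ℝ (Model n) (Model n))) (x, y) :=
    HasFDerivAt.comp (x, y) (L γ).hasFDerivAt hasFDerivAt_snd
  exact h1.mul h2.norm_sq

theorem dV_zeroForm {x y : Model n} {c : Fin N → Model n → ℝ}
    {G : Model n × Model n → ℝ} {L : Fin N → Model n →L[ℝ] Model n}
    (hc : ∀ γ, DifferentiableAt ℝ (c γ) x)
    (hG : G =ᶠ[𝓝 (x, y)] fun z => ∑ γ, c γ z.1 * ‖L γ z.2‖ ^ 2) :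
    dV (zeroForm G) (x, y) = ∑ γ, c γ x • ContinuousAlternatingMap.ofSubsingletonLIE (𝕜 := ℝ) (0 : Fin 1)
        ((2 : ℕ) • (innerSL ℝ (L γ y)).comp ((L γ).comp (.snd ℝ (Model n) (Model n)))) := by
  have h1 : HasFDerivAt G _ (x, y) := (hasFDerivAt_sum_smul_normSq hc L).congr_of_eventuallyEq hG
  let κ := (ContinuousAlternatingMap.constOfIsEmptyLIE ℝ (Model n × Model n) ℝ
    (Fin 0)).toContinuousLinearEquiv.toContinuousLinearMap
  have h2 : HasFDerivAt (zeroForm G) _ (x, y) :=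
    HasFDerivAt.comp (g := κ) (x, y) κ.hasFDerivAt h1
  rw [dV, h2.fderiv]
  ext v
  simp [ContinuousAlternatingMap.alternatizeUncurryFin_apply, sum_apply]
  rfl

/-- If near a point the function `G` is a sum of quadratic forms in `y` with coefficients depending
on `x`, then `½ d^H d^V G` is the two-form given by the derivatives of the coefficients. -/
theorem half_dH_dV_apply {x y : Model n} {c : Fin N → Model n → ℝ}
    {G : Model n × Model n → ℝ} {L : Fin N → Model n →L[ℝ] Model n}
    (hc : ∀ᶠ x' in 𝓝 x, ∀ γ, DifferentiableAt ℝ (c γ) x')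
    (hG : G =ᶠ[𝓝 (x, y)] fun z => ∑ γ, c γ z.1 * ‖L γ z.2‖ ^ 2) (u v : Model n × Model n) :
    ((1 / 2 : ℝ) • dH (dV (zeroForm G)) (x, y)) ![u, v] =
      ∑ γ, (fderiv ℝ (c γ) x u.1 * inner ℝ (L γ y) (L γ v.2) -
        fderiv ℝ (c γ) x v.1 * inner ℝ (L γ y) (L γ u.2)) := by
  have hev : dV (zeroForm G) =ᶠ[𝓝 (x, y)] fun z => ∑ γ, c γ z.1 •
      ContinuousAlternatingMap.ofSubsingletonLIE (𝕜 := ℝ) (0 : Fin 1)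
        ((2 : ℕ) • (innerSL ℝ (L γ z.2)).comp ((L γ).comp (.snd ℝ (Model n) (Model n)))) := by
    have hc' : ∀ᶠ z : Model n × Model n in 𝓝 (x, y), ∀ γ, DifferentiableAt ℝ (c γ) z.1 :=
      (continuous_fst.tendsto (x, y)).eventually hc
    filter_upwards [hc', hG.eventuallyEq_nhds] with z hz hz'
    exact dV_zeroForm hz hz'
  let κ := (ContinuousAlternatingMap.ofSubsingletonLIE (𝕜 := ℝ) (E := Model n × Model n) (F := ℝ)
    (0 : Fin 1)).toContinuousLinearEquiv.toContinuousLinearMap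
  let Λ : Fin N → Model n →L[ℝ] (Model n × Model n) [⋀^Fin 1]→L[ℝ] ℝ := fun γ =>
    κ.comp
      ((2 : ℕ) • (((ContinuousLinearMap.compL ℝ (Model n × Model n) (Model n) ℝ).flip
        ((L γ).comp (.snd ℝ (Model n) (Model n)))).comp ((innerSL ℝ).comp (L γ))))
  have hΛ : ∀ γ (w : Model n), Λ γ w = ContinuousAlternatingMap.ofSubsingletonLIE (𝕜 := ℝ) (0 : Fin 1)
        ((2 : ℕ) • (innerSL ℝ (L γ w)).comp ((L γ).comp (.snd ℝ (Model n) (Model n)))) :=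
    fun γ w => rfl
  have hd : HasFDerivAt (fun z : Model n × Model n => ∑ γ, c γ z.1 • Λ γ z.2)
      (∑ γ, (c γ x • (Λ γ).comp (.snd ℝ (Model n) (Model n)) +
        ((fderiv ℝ (c γ) x).comp (.fst ℝ (Model n) (Model n))).smulRight (Λ γ y))) (x, y) := by
    refine HasFDerivAt.fun_sum fun γ _ => ?_
    have h1 : HasFDerivAt (fun z : Model n × Model n => c γ z.1)
        ((fderiv ℝ (c γ) x).comp (.fst ℝ (Model n) (Model n))) (x, y) :=
      HasFDerivAt.comp (x, y) (hc.self_of_nhds γ).hasFDerivAt hasFDerivAt_fst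
    have h2 : HasFDerivAt (fun z : Model n × Model n => Λ γ z.2)
        ((Λ γ).comp (.snd ℝ (Model n) (Model n))) (x, y) :=
      HasFDerivAt.comp (x, y) (Λ γ).hasFDerivAt hasFDerivAt_snd
    exact h1.smul h2
  rw [dH, (hd.congr_of_eventuallyEq hev).fderiv]
  simp [ContinuousAlternatingMap.alternatizeUncurryFin_apply, sum_apply,
    Fin.sum_univ_two, hΛ, Fin.removeNth, Finset.mul_sum]
  rw [← sub_eq_add_neg, mul_sub, Finset.mul_sum, Finset.mul_sum]
  congr 1 <;> exact Finset.sum_congr rfl fun γ _ => by ring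

/-- The endomorphism `∑_γ D_γ ⊗ (L_γ^* L_γ y)`. -/
noncomputable def mixedMap {m : ℕ} (D : Fin N → EuclideanSpace ℝ (Fin m) →L[ℝ] ℝ)
    (L : Fin N → EuclideanSpace ℝ (Fin m) →L[ℝ] EuclideanSpace ℝ (Fin m))
    (y : EuclideanSpace ℝ (Fin m)) : EuclideanSpace ℝ (Fin m) →L[ℝ] EuclideanSpace ℝ (Fin m) :=
  ∑ γ, (D γ).smulRight ((L γ).adjoint (L γ y))

theorem mixedMap_apply {m : ℕ} (D : Fin N → EuclideanSpace ℝ (Fin m) →L[ℝ] ℝ)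
    (L : Fin N → EuclideanSpace ℝ (Fin m) →L[ℝ] EuclideanSpace ℝ (Fin m))
    (y u : EuclideanSpace ℝ (Fin m)) :
    mixedMap D L y u = ∑ γ, D γ u • (L γ).adjoint (L γ y) := by
  simp [mixedMap, sum_apply]

/-- The value on the standard frame of the top degree component of `exp (∑ₖ dxᵏ ∧ dyᵏ)`. -/
noncomputable def frameConst (n : ℕ) : ℝ :=
  (((2 * n).factorial : ℝ))⁻¹ * wedgePow (stdTwoForm n) (2 * n) (stdFrame n)

theorem expForm_apply_stdFrame {x y : Model n} {c : Fin N → Model n → ℝ}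
    {G : Model n × Model n → ℝ} {L : Fin N → Model n →L[ℝ] Model n}
    (hc : ∀ᶠ x' in 𝓝 x, ∀ γ, DifferentiableAt ℝ (c γ) x')
    (hG : G =ᶠ[𝓝 (x, y)] fun z => ∑ γ, c γ z.1 * ‖L γ z.2‖ ^ 2) :
    expForm ((1 / 2 : ℝ) • dH (dV (zeroForm G)) (x, y)).toAlternatingMap (G (x, y)) (2 * n)
      (stdFrame n) = frameConst n * ((mixedMap (fun γ => fderiv ℝ (c γ) x) L y).det *
        Real.exp (-∑ γ, c γ x * ‖L γ y‖ ^ 2)) := by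
  rw [expForm, AlternatingMap.smul_apply, hG.self_of_nhds, smul_eq_mul,
    wedgePow_apply_stdFrame _ (mixedMap (fun γ => fderiv ℝ (c γ) x) L y : Model n →ₗ[ℝ] Model n),
    frameConst, ContinuousLinearMap.det]
  · ring
  · intro u v
    refine (half_dH_dV_apply hc hG u v).trans ?_
    simp only [ContinuousLinearMap.coe_coe, mixedMap_apply, sum_inner, inner_smul_left,
      ContinuousLinearMap.adjoint_inner_left, Finset.sum_sub_distrib, conj_trivial]

end MixedDerivative
end FlatCover

namespace FlatCover

/-! ### Gaussian integrals -/

section Gaussian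

variable {E : Type*} [NormedAddCommGroup E] [InnerProductSpace ℝ E] [FiniteDimensional ℝ E]
  [MeasurableSpace E] [BorelSpace E]

theorem integrable_exp_neg_mul_normSq {c : ℝ} (hc : 0 < c) :
    Integrable (fun y : E => Real.exp (-c * ‖y‖ ^ 2)) := by
  have h := (GaussianFourier.integrable_cexp_neg_mul_sq_norm_add (V := E) (b := (c : ℂ))
    (by simpa using hc) 0 0).norm
  refine h.congr (Eventually.of_forall fun y => ?_)
  simp only [Complex.norm_exp]
  congr 1
  simp [← Complex.ofReal_pow, ← Complex.ofReal_neg, ← Complex.ofReal_mul]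

/-- Half of the Gaussian exponent is given up to absorb the polynomial, through `(1+t)^p ≤ p!
e^(1+t)` and the inequality `t ≤ (c/2) t² + 1/(2c)`, which is `(ct - 1)² ≥ 0`. -/
theorem one_add_pow_mul_exp_le {c : ℝ} (hc : 0 < c) (p : ℕ) {t : ℝ} (ht : 0 ≤ t) :
    (1 + t) ^ p * Real.exp (-c * t ^ 2) ≤
      p.factorial * Real.exp (1 + 1 / (2 * c)) * Real.exp (-(c / 2) * t ^ 2) := by
  have h1 : (1 + t) ^ p ≤ p.factorial * Real.exp (1 + t) := by
    have := Real.pow_div_factorial_le_exp (1 + t) (by positivity) p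
    rwa [div_le_iff₀' (by positivity)] at this
  have h2 : t ≤ c / 2 * t ^ 2 + 1 / (2 * c) := by
    have : 0 ≤ (c * t - 1) ^ 2 / (2 * c) := by positivity
    have e : (c * t - 1) ^ 2 / (2 * c) = c / 2 * t ^ 2 + 1 / (2 * c) - t := by field_simp; ring
    linarith
  calc (1 + t) ^ p * Real.exp (-c * t ^ 2)
      ≤ p.factorial * Real.exp (1 + t) * Real.exp (-c * t ^ 2) := by gcongr
    _ = p.factorial * Real.exp (1 + t - c * t ^ 2) := by
        rw [mul_assoc, ← Real.exp_add]; ring_nf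
    _ ≤ p.factorial * Real.exp (1 + 1 / (2 * c) + -(c / 2) * t ^ 2) := by
        gcongr; linarith
    _ = _ := by rw [Real.exp_add, mul_assoc]

theorem integrable_of_abs_le_gaussian {h : E → ℝ} (hh : Continuous h) {c C : ℝ} (hc : 0 < c)
    (p : ℕ) (hle : ∀ y, |h y| ≤ C * (1 + ‖y‖) ^ p * Real.exp (-c * ‖y‖ ^ 2)) : Integrable h := by
  have hC : 0 ≤ C := by
    have := (abs_nonneg _).trans (hle 0)
    simpa using this
  refine Integrable.mono' ((integrable_exp_neg_mul_normSq (E := E) (half_pos hc)).const_mul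
    (C * (p.factorial * Real.exp (1 + 1 / (2 * c))))) hh.aestronglyMeasurable
    (Eventually.of_forall fun y => (hle y).trans ?_)
  rw [mul_assoc, mul_assoc]
  exact mul_le_mul_of_nonneg_left (one_add_pow_mul_exp_le hc p (norm_nonneg y)) hC

/-- Substitution of `√l y` for `y`: the Jacobian and the factor `‖y‖^m` each contribute `l^(-m/2)`,
where `m` is the dimension. The full power `l^(-m)` is what balances a determinant with `m` columns
of size about `l ‖y‖`. -/
theorem integral_norm_pow_mul_exp {c l : ℝ} (hl : 0 < l) :
    ∫ y : E, ‖y‖ ^ Module.finrank ℝ E * Real.exp (-(c * l) * ‖y‖ ^ 2) =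
      (l ^ Module.finrank ℝ E)⁻¹ * ∫ y : E, ‖y‖ ^ Module.finrank ℝ E * Real.exp (-c * ‖y‖ ^ 2) := by
  have h := Measure.integral_comp_smul (volume : Measure E)
    (fun y : E => ‖y‖ ^ Module.finrank ℝ E * Real.exp (-c * ‖y‖ ^ 2)) (Real.sqrt l)
  set m := Module.finrank ℝ E
  have hs : 0 < Real.sqrt l := Real.sqrt_pos.2 hl
  have e : ∀ y : E, ‖Real.sqrt l • y‖ ^ m * Real.exp (-c * ‖Real.sqrt l • y‖ ^ 2) =
      Real.sqrt l ^ m * (‖y‖ ^ m * Real.exp (-(c * l) * ‖y‖ ^ 2)) := fun y => by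
    rw [norm_smul, Real.norm_of_nonneg hs.le, mul_pow, mul_pow, Real.sq_sqrt hl.le]
    ring_nf
  simp only [e] at h
  rw [integral_const_mul, abs_of_pos (by positivity), smul_eq_mul] at h
  have h3 : l ^ m = Real.sqrt l ^ m * Real.sqrt l ^ m := by
    rw [← mul_pow, Real.mul_self_sqrt hl.le]
  rw [h3, mul_inv, mul_assoc, ← h, inv_mul_cancel_left₀ (by positivity)]

end Gaussian

/-! ### Integration by parts for alternating forms against a Gaussian -/

section Alternating

variable {E : Type*} [NormedAddCommGroup E] [InnerProductSpace ℝ E]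
  {ι : Type*}

theorem abs_alternating_le_of_norm_le [Fintype ι] (η : E [⋀^ι]→L[ℝ] ℝ) {z : ι → E} {R : ℝ}
    (hz : ∀ i, ‖z i‖ ≤ R) : |η z| ≤ ‖η‖ * R ^ Fintype.card ι := by
  refine (η.le_opNorm z).trans (mul_le_mul_of_nonneg_left ?_ (norm_nonneg _))
  calc ∏ i, ‖z i‖ ≤ ∏ _i : ι, R := Finset.prod_le_prod (fun i _ => norm_nonneg _) fun i _ => hz i
    _ = R ^ Fintype.card ι := by simp

variable [DecidableEq ι]

theorem alternating_update_update_swap (η : E [⋀^ι]→L[ℝ] ℝ) (z : ι → E) {i j : ι} (h : i ≠ j)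
    (u w : E) : η (Function.update (Function.update z i u) j w) =
      -η (Function.update (Function.update z i w) j u) := by
  refine Eq.trans ?_
    (η.toAlternatingMap.map_swap (Function.update (Function.update z i w) j u) h)
  change η _ = η _
  congr 1
  funext k
  rcases eq_or_ne k i with rfl | hi
  · simp [h]
  rcases eq_or_ne k j with rfl | hj
  · simp [h]
  · simp [Equiv.swap_apply_of_ne_of_ne hi hj, hi, hj]

theorem alternating_update_eq_sum {κ : Type*} [Fintype κ] (η : E [⋀^ι]→L[ℝ] ℝ) (z : ι → E) (i : ι)
    (b : OrthonormalBasis κ ℝ E) (w : E) :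
    η (Function.update z i w) = ∑ k, inner ℝ (b k) w * η (Function.update z i (b k)) := by
  conv_lhs => rw [← b.sum_repr' w]
  refine (η.toAlternatingMap.map_update_sum Finset.univ i _ z).trans ?_
  exact Finset.sum_congr rfl fun l _ => η.toAlternatingMap.map_update_smul z i _ _

/-- The trace of a symmetric endomorphism against two slots of an alternating form vanishes. -/
theorem sum_alternating_update_symmetric_eq_zero {κ : Type*} [Fintype κ]
    (η : E [⋀^ι]→L[ℝ] ℝ) (z : ι → E) {i j : ι} (h : i ≠ j)
    (b : OrthonormalBasis κ ℝ E) (S : E →L[ℝ] E) (hS : ∀ u v, inner ℝ (S u) v = inner ℝ u (S v)) :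
    ∑ k, η (Function.update (Function.update z i (b k)) j (S (b k))) = 0 := by
  let s : κ → κ → ℝ := fun l k => inner ℝ (b l) (S (b k))
  have hs : ∀ l k, s l k = s k l := fun l k => by
    simp only [s]; rw [← hS, real_inner_comm]
  let D : κ → κ → ℝ := fun k l => η (Function.update (Function.update z i (b k)) j (b l))
  have e : ∀ k, η (Function.update (Function.update z i (b k)) j (S (b k))) =
      ∑ l, s l k * D k l :=
    fun k => alternating_update_eq_sum η _ j b _
  simp only [e]
  have hD : ∀ k l, D k l = -D l k := fun k l => alternating_update_update_swap η z h _ _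
  have : ∑ k, ∑ l, s l k * D k l = -∑ k, ∑ l, s l k * D k l := by
    conv_lhs => rw [Finset.sum_comm]
    -- After the exchange of the summation indices, symmetry of `s` and antisymmetry of `D` show
    -- that the double sum equals its own negative.
    rw [← Finset.sum_neg_distrib]
    refine Finset.sum_congr rfl fun l _ => ?_
    rw [← Finset.sum_neg_distrib]
    refine Finset.sum_congr rfl fun k _ => ?_
    rw [hs, hD, mul_neg]
  linarith

variable [Fintype ι]

theorem hasFDerivAt_alternating_update (η : E [⋀^ι]→L[ℝ] ℝ) (S : ι → E →L[ℝ] E) (i : ι) (u y : E) :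
    HasFDerivAt (fun y : E => η (Function.update (fun j => S j y) i u))
      ((η.1.linearDeriv (Function.update (fun j => S j y) i u)).comp
        (ContinuousLinearMap.pi (Function.update S i 0))) y := by
  -- Slot `i` holds the constant `u`, hence the `0` in the derivative.
  have h : HasFDerivAt (fun y : E => Function.update (fun j => S j y) i u)
      (ContinuousLinearMap.pi (Function.update S i 0)) y := by
    rw [hasFDerivAt_pi]
    intro j
    by_cases hj : j = i
    · subst hj
      simpa using hasFDerivAt_const u y
    · simpa [hj] using (S j).hasFDerivAt
  exact (η.hasFDerivAt _).comp y h

theorem fderiv_alternating_update_apply (η : E [⋀^ι]→L[ℝ] ℝ) (S : ι → E →L[ℝ] E) (i : ι)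
    (u y v : E) :
    fderiv ℝ (fun y : E => η (Function.update (fun j => S j y) i u)) y v =
      ∑ j, η (Function.update (Function.update (fun j => S j y) i u) j
        (Function.update S i 0 j v)) := by
  rw [(hasFDerivAt_alternating_update η S i u y).fderiv]
  simp [ContinuousMultilinearMap.linearDeriv_apply]

/-- The vector field with components `η(…, b k in slot i, …)` is divergence free: differentiating
slot `j ≠ i` puts `S j (b k)` there against `b k` in slot `i`, which is a symmetric tensor
contracted with an alternating one. -/
theorem sum_fderiv_alternating_update_eq_zero {κ : Type*} [Fintype κ] (η : E [⋀^ι]→L[ℝ] ℝ)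
    (S : ι → E →L[ℝ] E) (hS : ∀ j u v, inner ℝ (S j u) v = inner ℝ u (S j v)) (i : ι)
    (b : OrthonormalBasis κ ℝ E) (y : E) :
    ∑ k, fderiv ℝ (fun y : E => η (Function.update (fun j => S j y) i (b k))) y (b k) = 0 := by
  simp only [fderiv_alternating_update_apply]
  rw [Finset.sum_comm]
  refine Finset.sum_eq_zero fun j _ => ?_
  by_cases hj : j = i
  · subst hj
    exact Finset.sum_eq_zero fun k _ => η.map_coord_zero j (by simp)
  · simp only [Function.update_of_ne hj]
    exact sum_alternating_update_symmetric_eq_zero η _ (Ne.symm hj) b (S j) (hS j)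

variable [FiniteDimensional ℝ E] [MeasurableSpace E] [BorelSpace E]

/-- Integration by parts against a Gaussian: if one of the slots of the alternating form is the
gradient of the exponent and the others are symmetric, the Gaussian integral vanishes. -/
theorem integral_alternating_gradient_eq_zero (η : E [⋀^ι]→L[ℝ] ℝ) (S : ι → E →L[ℝ] E)
    (hS : ∀ j u v, inner ℝ (S j u) v = inner ℝ u (S j v)) (i : ι) (Q : E →L[ℝ] E)
    (hQ : ∀ u v, inner ℝ (Q u) v = inner ℝ u (Q v)) {c : ℝ} (hc : 0 < c)
    (hpos : ∀ y, c * ‖y‖ ^ 2 ≤ inner ℝ (Q y) y) :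
    ∫ y, η (Function.update (fun j => S j y) i (Q y)) * Real.exp (-inner ℝ (Q y) y) = 0 := by
  let b := stdOrthonormalBasis ℝ E
  let g : E → ℝ := fun y => Real.exp (-inner ℝ (Q y) y)
  have hg : ∀ y, HasFDerivAt g (g y • (-((2 : ℝ) • innerSL ℝ (Q y)))) y := fun y => by
    have h := (((Q.hasFDerivAt (x := y)).inner ℝ (hasFDerivAt_id y)).neg).exp
    refine h.congr_fderiv ?_
    ext v
    simp [g, hQ v y, real_inner_comm v (Q y)]
    ring
  have hgc : Continuous g := by fun_prop
  have hgle : ∀ y, g y ≤ Real.exp (-c * ‖y‖ ^ 2) := fun y =>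
    Real.exp_le_exp.2 (by linarith [hpos y])
  let f : Fin (Module.finrank ℝ E) → E → ℝ :=
    fun k y => η (Function.update (fun j => S j y) i (b k))
  have hf : ∀ k y, DifferentiableAt ℝ (f k) y :=
    fun k y => (hasFDerivAt_alternating_update η S i (b k) y).differentiableAt
  have hfc : ∀ k, Continuous (f k) := fun k => (show Differentiable ℝ (f k) from hf k).continuous
  -- A common bound for all slots; it serves only to dominate every integrand by a polynomial times
  -- a Gaussian, as integration by parts on the whole space requires.
  obtain ⟨K, hK1, hKQ, hKS⟩ : ∃ K : ℝ, 1 ≤ K ∧ ‖Q‖ ≤ K ∧ ∀ j, ‖S j‖ ≤ K := by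
    refine ⟨1 + ‖Q‖ + ∑ j, ‖S j‖, ?_, ?_, fun j => ?_⟩
    · have : 0 ≤ ∑ j, ‖S j‖ := Finset.sum_nonneg fun j _ => norm_nonneg _
      linarith [norm_nonneg Q]
    · have : 0 ≤ ∑ j, ‖S j‖ := Finset.sum_nonneg fun j _ => norm_nonneg _
      linarith [norm_nonneg Q]
    · have := Finset.single_le_sum (f := fun j => ‖S j‖) (fun j _ => norm_nonneg _)
        (Finset.mem_univ j)
      linarith [norm_nonneg Q]
  have hR : ∀ y : E, K ≤ K * (1 + ‖y‖) := fun y => by nlinarith [norm_nonneg y]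
  have hb : ∀ k, ‖b k‖ = 1 := fun k => b.orthonormal.1 k
  have hSy : ∀ j (y : E), ‖S j y‖ ≤ K * (1 + ‖y‖) := fun j y =>
    ((S j).le_of_opNorm_le (hKS j) y).trans (by nlinarith [norm_nonneg y])
  have hslot : ∀ k y j, ‖Function.update (fun j => S j y) i (b k) j‖ ≤ K * (1 + ‖y‖) :=
    fun k y j => by
      by_cases hj : j = i
      · subst hj; simpa [hb] using hK1.trans (hR y)
      · simpa [hj] using hSy j y
  set d := Fintype.card ι
  have hfle : ∀ k y, |f k y| ≤ ‖η‖ * K ^ d * (1 + ‖y‖) ^ d := fun k y => by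
    refine (abs_alternating_le_of_norm_le η (hslot k y)).trans_eq ?_
    rw [mul_pow, mul_assoc]
  have hf'le : ∀ k y, |fderiv ℝ (f k) y (b k)| ≤ d * (‖η‖ * K ^ d * (1 + ‖y‖) ^ d) := fun k y => by
    simp only [f, fderiv_alternating_update_apply]
    refine (Finset.abs_sum_le_sum_abs _ _).trans ?_
    have : ∀ j ∈ Finset.univ, |η (Function.update (Function.update (fun j => S j y) i (b k)) j
        (Function.update S i 0 j (b k)))| ≤ ‖η‖ * K ^ d * (1 + ‖y‖) ^ d := fun j _ => by
      refine (abs_alternating_le_of_norm_le η (R := K * (1 + ‖y‖)) fun l => ?_).trans_eq ?_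
      · by_cases hl : l = j
        · subst hl
          by_cases hi : l = i
          · subst hi; simp; positivity
          · simp only [Function.update_self, Function.update_of_ne hi]
            refine ((S l).le_of_opNorm_le (hKS l) _).trans ?_
            rw [hb, mul_one]; exact hR y
        · rw [Function.update_of_ne hl]; exact hslot k y l
      · rw [mul_pow, mul_assoc]
    refine (Finset.sum_le_sum this).trans_eq ?_
    simp [d]
  have hf'c : ∀ k, Continuous fun y => fderiv ℝ (f k) y (b k) := fun k => by
    simp only [f, fderiv_alternating_update_apply]
    refine continuous_finsetSum _ fun j _ => η.cont.comp ?_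
    refine Continuous.update (Continuous.update ?_ _ continuous_const) _ continuous_const
    exact continuous_pi fun j => (S j).continuous
  have hg'le : ∀ k y, |fderiv ℝ g y (b k)| ≤ 2 * K * (1 + ‖y‖) * Real.exp (-c * ‖y‖ ^ 2) :=
    fun k y => by
      rw [(hg y).fderiv]
      simp only [smul_apply, neg_apply, smul_eq_mul,
        abs_mul, abs_neg, innerSL_apply_apply]
      have h1 : |inner ℝ (Q y) (b k)| ≤ K * (1 + ‖y‖) := by
        refine (abs_real_inner_le_norm _ _).trans ?_
        rw [hb, mul_one]
        exact (Q.le_of_opNorm_le hKQ y).trans (by nlinarith [norm_nonneg y])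
      rw [abs_of_pos (Real.exp_pos _), abs_of_pos (two_pos)]
      calc g y * (2 * |inner ℝ (Q y) (b k)|)
          ≤ Real.exp (-c * ‖y‖ ^ 2) * (2 * (K * (1 + ‖y‖))) := by
            gcongr
            exact hgle y
        _ = _ := by ring
  have hg'c : ∀ k, Continuous fun y => fderiv ℝ g y (b k) := fun k => by
    have : (fun y => fderiv ℝ g y (b k)) = fun y => g y * -(2 * inner ℝ (Q y) (b k)) := by
      funext y; rw [(hg y).fderiv]; simp
    rw [this]; fun_prop
  have hparts : ∀ k, ∫ y, f k y * fderiv ℝ g y (b k) = -∫ y, fderiv ℝ (f k) y (b k) * g y :=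
    fun k => by
      refine integral_mul_fderiv_eq_neg_fderiv_mul_of_integrable ?_ ?_ ?_
        (fun y _ => hf k y) (fun y _ => (hg y).differentiableAt)
      · refine integrable_of_abs_le_gaussian ((hf'c k).mul hgc) hc d
          (C := d * (‖η‖ * K ^ d)) fun y => ?_
        rw [abs_mul, abs_of_pos (Real.exp_pos _)]
        refine (mul_le_mul (hf'le k y) (hgle y) (Real.exp_pos _).le (by positivity)).trans_eq ?_
        ring
      · refine integrable_of_abs_le_gaussian ((hfc k).mul (hg'c k)) hc (d + 1)
          (C := ‖η‖ * K ^ d * (2 * K)) fun y => ?_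
        rw [abs_mul]
        refine (mul_le_mul (hfle k y) (hg'le k y) (abs_nonneg _) (by positivity)).trans_eq ?_
        ring
      · refine integrable_of_abs_le_gaussian ((hfc k).mul hgc) hc d
          (C := ‖η‖ * K ^ d) fun y => ?_
        rw [abs_mul, abs_of_pos (Real.exp_pos _)]
        exact mul_le_mul (hfle k y) (hgle y) (Real.exp_pos _).le (by positivity)
  have hint : ∀ k, Integrable fun y => fderiv ℝ (f k) y (b k) * g y := fun k => by
    refine integrable_of_abs_le_gaussian ((hf'c k).mul hgc) hc d
      (C := d * (‖η‖ * K ^ d)) fun y => ?_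
    rw [abs_mul, abs_of_pos (Real.exp_pos _)]
    refine (mul_le_mul (hf'le k y) (hgle y) (Real.exp_pos _).le (by positivity)).trans_eq ?_
    ring
  have hint' : ∀ k, Integrable fun y => f k y * fderiv ℝ g y (b k) := fun k => by
    refine integrable_of_abs_le_gaussian ((hfc k).mul (hg'c k)) hc (d + 1)
      (C := ‖η‖ * K ^ d * (2 * K)) fun y => ?_
    rw [abs_mul]
    refine (mul_le_mul (hfle k y) (hg'le k y) (abs_nonneg _) (by positivity)).trans_eq ?_
    ring
  -- As `∇g = -2 g Q y`, the integrand is `-½` times the derivative of `g` along the divergence-free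
  -- field with components `f k`.
  have e : ∀ y, η (Function.update (fun j => S j y) i (Q y)) * Real.exp (-inner ℝ (Q y) y) =
      -(1 / 2) * ∑ k, f k y * fderiv ℝ g y (b k) := fun y => by
    rw [alternating_update_eq_sum η _ i b, Finset.sum_mul, Finset.mul_sum]
    refine Finset.sum_congr rfl fun k _ => ?_
    rw [(hg y).fderiv]
    simp only [smul_apply, neg_apply, smul_eq_mul,
      innerSL_apply_apply, f, g, real_inner_comm (Q y)]
    ring
  simp only [e]
  rw [integral_const_mul, integral_finsetSum _ fun k _ => hint' k]
  simp only [hparts]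
  rw [Finset.sum_neg_distrib, ← integral_finsetSum _ fun k _ => hint k]
  simp only [← Finset.sum_mul, f, sum_fderiv_alternating_update_eq_zero η S hS i b, zero_mul,
    integral_zero, neg_zero, mul_zero]

end Alternating
end FlatCover

namespace FlatCover

/-! ### Fibre integrals when one direction is almost degenerate -/

section PointwiseBound

variable {m N : ℕ}

/-- Lets a prescribed direction `v` be one of the columns of the determinant. -/
theorem exists_orthonormalBasis_apply_eq {v : EuclideanSpace ℝ (Fin m)} (hv : ‖v‖ = 1) :
    ∃ (i : Fin m) (b : OrthonormalBasis (Fin m) ℝ (EuclideanSpace ℝ (Fin m))), b i = v := by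
  have hm : 0 < m := by
    rcases Nat.eq_zero_or_pos m with rfl | h
    · have : v = 0 := Subsingleton.elim _ _
      simp [this] at hv
    · exact h
  obtain ⟨b, hb⟩ := Orthonormal.exists_orthonormalBasis_extension_of_card_eq
    (𝕜 := ℝ) (E := EuclideanSpace ℝ (Fin m)) (ι := Fin m) (by simp) (v := fun _ => v)
    (s := {⟨0, hm⟩}) (by
      rw [orthonormal_iff_ite]
      rintro ⟨i, rfl⟩ ⟨j, rfl⟩
      simp [hv])
  exact ⟨⟨0, hm⟩, b, hb _ rfl⟩

/-- The determinant form of an orthonormal basis, as a continuous alternating map. -/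
theorem exists_continuousAlternatingMap_det (b : OrthonormalBasis (Fin m) ℝ (EuclideanSpace ℝ (Fin m))) :
    ∃ η : EuclideanSpace ℝ (Fin m) [⋀^Fin m]→L[ℝ] ℝ, (∀ z, |η z| ≤ ∏ i, ‖z i‖) ∧
      ∀ A : EuclideanSpace ℝ (Fin m) →L[ℝ] EuclideanSpace ℝ (Fin m), A.det = η fun j => A (b j) := by
  have : Fact (Module.finrank ℝ (EuclideanSpace ℝ (Fin m)) = m) := ⟨by simp⟩
  have hle : ∀ z, |b.toBasis.det z| ≤ ∏ i, ‖z i‖ := fun z => by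
    rw [← b.toBasis.orientation.volumeForm_robust b rfl]
    exact Orientation.abs_volumeForm_apply_le _ z
  refine ⟨b.toBasis.det.mkContinuous 1 fun z => by simpa using hle z, hle, fun A => ?_⟩
  have h := b.toBasis.det_comp (A : EuclideanSpace ℝ (Fin m) →ₗ[ℝ] EuclideanSpace ℝ (Fin m)) b.toBasis
  rw [b.toBasis.det_self, mul_one] at h
  exact h.symm.trans (by congr 1)

/-- Hadamard's inequality for the columns in an orthonormal basis. -/
theorem abs_det_le_of_norm_le {A : EuclideanSpace ℝ (Fin m) →L[ℝ] EuclideanSpace ℝ (Fin m)} {R : ℝ}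
    (h : ∀ u, ‖A u‖ ≤ R * ‖u‖) : |A.det| ≤ R ^ m := by
  let b := EuclideanSpace.basisFun (Fin m) ℝ
  obtain ⟨η, hη, hdet⟩ := exists_continuousAlternatingMap_det b
  rw [hdet]
  refine (hη _).trans ((Finset.prod_le_prod (fun i _ => norm_nonneg _) fun i _ => ?_).trans_eq
    (by rw [Finset.prod_const, Finset.card_univ, Fintype.card_fin]))
  simpa [b.orthonormal.1 i] using h (b i)

/-- If the density `det (∑ D_γ ⊗ L_γ^* L_γ y) exp (-∑ w_γ |L_γ y|²)` is almost degenerate in a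
direction `v`, up to a multiple of the gradient of the exponent, then its integral is small. -/
theorem abs_integral_det_mixedMap_le (D : Fin N → EuclideanSpace ℝ (Fin m) →L[ℝ] ℝ)
    (L : Fin N → EuclideanSpace ℝ (Fin m) →L[ℝ] EuclideanSpace ℝ (Fin m)) (w : Fin N → ℝ)
    {c l K ε μ : ℝ} (hc : 0 < c) (hl : 0 < l) (hK0 : 0 ≤ K) (hε0 : 0 ≤ ε)
    (hpos : ∀ y, c * l * ‖y‖ ^ 2 ≤ ∑ γ, w γ * ‖L γ y‖ ^ 2)
    (hK : ∀ y u, ‖mixedMap D L y u‖ ≤ K * ‖y‖ * ‖u‖)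
    {v : EuclideanSpace ℝ (Fin m)} (hv : ‖v‖ = 1)
    (hε : ∀ y, ‖∑ γ, (D γ v - μ * w γ) • (L γ).adjoint (L γ y)‖ ≤ ε * ‖y‖) :
    |∫ y, (mixedMap D L y).det * Real.exp (-∑ γ, w γ * ‖L γ y‖ ^ 2)| ≤
      ε * K ^ (m - 1) * (l ^ m)⁻¹ *
        ∫ y : EuclideanSpace ℝ (Fin m), ‖y‖ ^ m * Real.exp (-c * ‖y‖ ^ 2) := by
  obtain ⟨i, b, hb⟩ := exists_orthonormalBasis_apply_eq hv
  obtain ⟨η, hη, hdet⟩ := exists_continuousAlternatingMap_det b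
  have hcl : 0 < c * l := mul_pos hc hl
  let P : Fin N → EuclideanSpace ℝ (Fin m) →L[ℝ] EuclideanSpace ℝ (Fin m) :=
    fun γ => (L γ).adjoint.comp (L γ)
  have hP : ∀ γ u v, inner ℝ (P γ u) v = inner ℝ u (P γ v) := fun γ u v => by
    simp [P, ContinuousLinearMap.adjoint_inner_left, ContinuousLinearMap.adjoint_inner_right]
  have hsum : ∀ (a : Fin N → ℝ) u v,
      inner ℝ ((∑ γ, a γ • P γ) u) v = inner ℝ u ((∑ γ, a γ • P γ) v) := fun a u v => by
    simp only [sum_apply, smul_apply, sum_inner, inner_sum, inner_smul_left, inner_smul_right, hP,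
      conj_trivial]
  let S : Fin m → EuclideanSpace ℝ (Fin m) →L[ℝ] EuclideanSpace ℝ (Fin m) :=
    fun j => ∑ γ, D γ (b j) • P γ
  have hS : ∀ j u v, inner ℝ (S j u) v = inner ℝ u (S j v) := fun j => hsum _
  let Q : EuclideanSpace ℝ (Fin m) →L[ℝ] EuclideanSpace ℝ (Fin m) := ∑ γ, w γ • P γ
  let R : EuclideanSpace ℝ (Fin m) →L[ℝ] EuclideanSpace ℝ (Fin m) := ∑ γ, (D γ v - μ * w γ) • P γ
  have hQy : ∀ y, inner ℝ (Q y) y = ∑ γ, w γ * ‖L γ y‖ ^ 2 := fun y => by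
    simp [Q, P, sum_apply, sum_inner, inner_smul_left, ContinuousLinearMap.adjoint_inner_left]
  have hSy : ∀ j y, S j y = mixedMap D L y (b j) := fun j y => by
    simp [S, P, mixedMap_apply, sum_apply]
  have hSnorm : ∀ j y, ‖S j y‖ ≤ K * ‖y‖ := fun j y => by
    rw [hSy]; simpa [b.orthonormal.1 j] using hK y (b j)
  have hR : ∀ y, ‖R y‖ ≤ ε * ‖y‖ := fun y => by simpa [R, P, sum_apply] using hε y
  -- The column in direction `v` splits into the small error `R` and a multiple of `Q`, where `Q y`
  -- is half the gradient of the exponent; the `Q` part integrates to zero.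
  have hSi : S i = R + μ • Q := by
    simp only [S, R, Q, hb, Finset.smul_sum, ← Finset.sum_add_distrib, smul_smul]
    exact Finset.sum_congr rfl fun γ _ => by module
  have hsplit : ∀ y, (mixedMap D L y).det = η (Function.update (fun j => S j y) i (R y)) +
      μ * η (Function.update (fun j => S j y) i (Q y)) := fun y => by
    have h0 : (fun j => mixedMap D L y (b j)) =
        Function.update (fun j => S j y) i (R y + μ • Q y) := by
      funext j
      by_cases hj : j = i
      · subst hj; simp [← hSy, hSi]
      · simp [hj, hSy]
    rw [hdet, h0, η.map_update_add, η.map_update_smul, smul_eq_mul]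
  have hm : m - 1 + 1 = m := Nat.sub_add_cancel i.pos
  -- Stated for a general `A` in slot `i`: with the operator norm it gives integrability of both
  -- parts, and with `R` and `ε` the final estimate.
  have hbound : ∀ (A : EuclideanSpace ℝ (Fin m) →L[ℝ] EuclideanSpace ℝ (Fin m)) (a : ℝ), 0 ≤ a →
      (∀ y, ‖A y‖ ≤ a * ‖y‖) → ∀ y, |η (Function.update (fun j => S j y) i (A y)) *
        Real.exp (-∑ γ, w γ * ‖L γ y‖ ^ 2)| ≤
          a * K ^ (m - 1) * (‖y‖ ^ m * Real.exp (-(c * l) * ‖y‖ ^ 2)) := fun A a ha hA y => by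
    have h1 : |η (Function.update (fun j => S j y) i (A y))| ≤ a * K ^ (m - 1) * ‖y‖ ^ m := by
      refine (hη _).trans ?_
      rw [← Finset.mul_prod_erase _ _ (Finset.mem_univ i), Function.update_self]
      have h2 : ∏ j ∈ Finset.univ.erase i, ‖Function.update (fun j => S j y) i (A y) j‖ ≤
          (K * ‖y‖) ^ (m - 1) := by
        refine (Finset.prod_le_prod (fun _ _ => norm_nonneg _) (g := fun _ => K * ‖y‖)
          fun j hj => ?_).trans_eq ?_
        · rw [Function.update_of_ne (Finset.ne_of_mem_erase hj)]; exact hSnorm j y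
        · simp [Finset.card_erase_of_mem]
      refine (mul_le_mul (hA y) h2 (Finset.prod_nonneg fun _ _ => norm_nonneg _)
        (by positivity)).trans_eq ?_
      have hp : ‖y‖ ^ m = ‖y‖ ^ (m - 1) * ‖y‖ := by rw [← pow_succ, hm]
      rw [hp]
      ring
    rw [abs_mul, abs_of_pos (Real.exp_pos _), ← mul_assoc]
    refine mul_le_mul h1 (Real.exp_le_exp.2 ?_) (Real.exp_pos _).le (by positivity)
    linarith [hpos y]
  have hcont : ∀ A : EuclideanSpace ℝ (Fin m) →L[ℝ] EuclideanSpace ℝ (Fin m), Continuous fun y =>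
      η (Function.update (fun j => S j y) i (A y)) * Real.exp (-∑ γ, w γ * ‖L γ y‖ ^ 2) := fun A => by
    refine Continuous.mul (η.cont.comp ?_) (by fun_prop)
    exact Continuous.update (continuous_pi fun j => (S j).continuous) _ A.continuous
  have hgauss : Integrable fun y : EuclideanSpace ℝ (Fin m) =>
      ‖y‖ ^ m * Real.exp (-(c * l) * ‖y‖ ^ 2) := by
    refine integrable_of_abs_le_gaussian (by fun_prop) hcl m (C := 1) fun y => ?_
    rw [abs_of_nonneg (by positivity), one_mul]
    gcongr
    linarith
  have hint : ∀ A : EuclideanSpace ℝ (Fin m) →L[ℝ] EuclideanSpace ℝ (Fin m), Integrable fun y =>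
      η (Function.update (fun j => S j y) i (A y)) * Real.exp (-∑ γ, w γ * ‖L γ y‖ ^ 2) := fun A =>
    (hgauss.const_mul (‖A‖ * K ^ (m - 1))).mono' (hcont A).aestronglyMeasurable
      (Eventually.of_forall fun y => hbound A ‖A‖ (norm_nonneg _) A.le_opNorm y)
  have hzero : ∫ y, η (Function.update (fun j => S j y) i (Q y)) *
      Real.exp (-∑ γ, w γ * ‖L γ y‖ ^ 2) = 0 := by
    simp only [← hQy]
    exact integral_alternating_gradient_eq_zero η S hS i Q (hsum _) hcl fun y => by
      rw [hQy]; exact hpos y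
  have heq : ∫ y, (mixedMap D L y).det * Real.exp (-∑ γ, w γ * ‖L γ y‖ ^ 2) =
      ∫ y, η (Function.update (fun j => S j y) i (R y)) *
        Real.exp (-∑ γ, w γ * ‖L γ y‖ ^ 2) := by
    simp only [hsplit, add_mul, mul_assoc]
    rw [integral_add (hint R) ((hint Q).const_mul μ), integral_const_mul, hzero, mul_zero, add_zero]
  rw [heq, ← Real.norm_eq_abs]
  refine (norm_integral_le_of_norm_le (hgauss.const_mul (ε * K ^ (m - 1)))
    (Eventually.of_forall fun y => hbound R ε hε0 hR y)).trans_eq ?_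
  have hs := integral_norm_pow_mul_exp (E := EuclideanSpace ℝ (Fin m)) (c := c) hl
  rw [finrank_euclideanSpace, Fintype.card_fin] at hs
  rw [integral_const_mul, hs, mul_assoc, mul_assoc, mul_assoc]

end PointwiseBound
end FlatCover

namespace FlatCover

/-! ### Power counting in `T` for the fibre integrals -/

section Decay

variable {m N : ℕ}

/-- Fewer equations than unknowns. This is how the bound on the number of boundaries above the index
`a` produces the degenerate direction. -/
theorem exists_unit_vector_of_card_lt (J : Finset (Fin N)) (hJ : J.card < m)
    (Λ : Fin N → EuclideanSpace ℝ (Fin m) →L[ℝ] ℝ) :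
    ∃ v : EuclideanSpace ℝ (Fin m), ‖v‖ = 1 ∧ ∀ γ ∈ J, Λ γ v = 0 := by
  let A : EuclideanSpace ℝ (Fin m) →ₗ[ℝ] (J → ℝ) :=
    LinearMap.pi fun γ => (Λ γ : EuclideanSpace ℝ (Fin m) →ₗ[ℝ] ℝ)
  obtain ⟨u, hu, hu0⟩ := (Submodule.ne_bot_iff _).1
    (LinearMap.ker_ne_bot_of_finrank_lt (f := A) (by simpa using hJ))
  have hA : ∀ γ ∈ J, Λ γ u = 0 := fun γ hγ => congrFun (LinearMap.mem_ker.1 hu) ⟨γ, hγ⟩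
  refine ⟨‖u‖⁻¹ • u, ?_, fun γ hγ => by simp [hA γ hγ]⟩
  rw [norm_smul, norm_inv, norm_norm, inv_mul_cancel₀ (norm_ne_zero_iff.2 hu0)]

theorem norm_sum_smul_adjoint_le (L : Fin N → EuclideanSpace ℝ (Fin m) →L[ℝ] EuclideanSpace ℝ (Fin m))
    {Λ A : ℝ} (hΛ : ∀ γ, ‖L γ‖ ≤ Λ) (t : Fin N → ℝ) (hA : ∀ γ, |t γ| ≤ A)
    (y : EuclideanSpace ℝ (Fin m)) :
    ‖∑ γ, t γ • (L γ).adjoint (L γ y)‖ ≤ N * Λ ^ 2 * A * ‖y‖ := by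
  have h : ∀ γ ∈ Finset.univ, ‖t γ • (L γ).adjoint (L γ y)‖ ≤ Λ ^ 2 * A * ‖y‖ := fun γ _ => by
    have hΛ0 : 0 ≤ Λ := (norm_nonneg _).trans (hΛ γ)
    have h1 : ‖(L γ).adjoint (L γ y)‖ ≤ Λ * (Λ * ‖y‖) := by
      refine ((L γ).adjoint.le_of_opNorm_le (c := Λ) (by simpa using hΛ γ) _).trans ?_
      exact mul_le_mul_of_nonneg_left ((L γ).le_of_opNorm_le (hΛ γ) y) hΛ0
    rw [norm_smul, Real.norm_eq_abs]
    refine (mul_le_mul (hA γ) h1 (norm_nonneg _) ((abs_nonneg _).trans (hA γ))).trans_eq ?_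
    ring
  refine (norm_sum_le_of_le _ h).trans_eq ?_
  simp
  ring

/-- If `δ ^ k ≤ K q ^ (k - 1)`, then `δ` loses at most a `k`-th root of the scale against `q`. -/
theorem scaled_le_of_pow_le {δ q t l K τ : ℝ} {k : ℕ} (hk : 0 < k) (hq : 0 ≤ q)
    (ht : 0 ≤ t) (hl : 1 ≤ l) (hK : 1 ≤ K) (hτ : 0 ≤ τ) (htτ : t ≤ τ ^ k) (htq : t * q ≤ l)
    (h : δ ^ k ≤ K * q ^ (k - 1)) : t * δ ≤ K * τ * l := by
  have hk' : k - 1 + 1 = k := Nat.sub_add_cancel hk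
  refine le_of_pow_le_pow_left₀ hk.ne' (by positivity) ?_
  calc (t * δ) ^ k = t ^ k * δ ^ k := mul_pow _ _ _
    _ ≤ t ^ k * (K * q ^ (k - 1)) := by gcongr
    _ = K * t * (t * q) ^ (k - 1) := by
        rw [mul_pow]; nth_rw 1 [← hk']; rw [pow_succ]; ring
    _ ≤ K * τ ^ k * l ^ (k - 1) := by gcongr
    _ ≤ K ^ k * τ ^ k * l ^ k := by
        gcongr
        · exact le_self_pow₀ hK hk.ne'
        · omega
    _ = (K * τ * l) ^ k := by rw [mul_pow, mul_pow]

/-- Since `l ≥ T^(a+1)`, the factor `T^a / l` gains `T⁻¹ = τ^(-2m)`, while the `m - 1` other columns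
lose only `τ^(m-1)`. -/
theorem pow_scale_le {A B T l τ : ℝ} {m a : ℕ} (hm : 0 < m) (hτ : 1 ≤ τ) (hT : T = τ ^ (2 * m))
    (hA : 0 ≤ A) (hB : 0 ≤ B) (hl : 0 < l) (hTa : T ^ (a + 1) ≤ l) :
    B * T ^ a * (A * τ * l) ^ (m - 1) * (l ^ m)⁻¹ ≤ B * A ^ (m - 1) * τ⁻¹ := by
  have hτ0 : 0 < τ := one_pos.trans_le hτ
  have hT0 : 0 < T := hT ▸ pow_pos hτ0 _
  rw [← div_eq_mul_inv, div_le_iff₀ (by positivity)]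
  have hlm : l ^ m = l ^ (m - 1) * l := by rw [← pow_succ, Nat.sub_add_cancel hm]
  have h2 : T ^ a * τ ^ (m - 1) ≤ τ⁻¹ * l := by
    rw [inv_mul_eq_div, le_div_iff₀ hτ0]
    calc T ^ a * τ ^ (m - 1) * τ = T ^ a * τ ^ m := by
          rw [mul_assoc, ← pow_succ, Nat.sub_add_cancel hm]
      _ ≤ T ^ a * T := by
          refine mul_le_mul_of_nonneg_left ?_ (by positivity)
          rw [hT]
          exact pow_le_pow_right₀ hτ (by omega)
      _ ≤ l := by rw [← pow_succ]; exact hTa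
  rw [hlm]
  calc B * T ^ a * (A * τ * l) ^ (m - 1)
      = B * A ^ (m - 1) * l ^ (m - 1) * (T ^ a * τ ^ (m - 1)) := by
        rw [mul_pow, mul_pow]; ring
    _ ≤ B * A ^ (m - 1) * l ^ (m - 1) * (τ⁻¹ * l) :=
        mul_le_mul_of_nonneg_left h2 (by positivity)
    _ = _ := by ring

/-- The fibre integrals of the Euler density decay as `T = τ ^ (2 m)` tends to infinity if fewer
than `m` weights have an index above `a`. -/
theorem exists_abs_integral_det_mixedMap_le
    (L : Fin N → EuclideanSpace ℝ (Fin m) →L[ℝ] EuclideanSpace ℝ (Fin m)) (a : Fin N)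
    (J : Finset (Fin N)) (hJa : ∀ γ ∈ J, a < γ) (hJm : J.card < m) {κ c₀ K₀ K₁ : ℝ}
    (hκ : 0 < κ) (hc₀ : 0 < c₀) (hK₀ : 0 ≤ K₀) (hK₁ : 1 ≤ K₁)
    (hL : ∀ γ, γ = a ∨ γ ∈ J → ∀ y, κ * ‖y‖ ≤ ‖L γ y‖) :
    ∃ C : ℝ, ∀ (q : Fin N → ℝ) (δ : Fin N → EuclideanSpace ℝ (Fin m) →L[ℝ] ℝ),
      (∀ γ, 0 ≤ q γ) → (∀ γ, q γ ≤ K₀) → (∀ γ, ‖δ γ‖ ≤ K₀) → c₀ ≤ q a →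
      (∀ γ ∈ J, ‖δ γ‖ ^ (2 * m * N) ≤ K₁ * q γ ^ (2 * m * N - 1)) →
      (∀ γ, a < γ → γ ∉ J → q γ = 0 ∧ δ γ = 0) → ∀ τ : ℝ, 1 ≤ τ →
      |∫ y, (mixedMap (fun γ => (τ ^ (2 * m)) ^ ((γ : ℕ) + 1) • δ γ) L y).det *
        Real.exp (-∑ γ, q γ * (τ ^ (2 * m)) ^ ((γ : ℕ) + 1) * ‖L γ y‖ ^ 2)| ≤ C * τ⁻¹ := by
  obtain ⟨Λ, hΛ0, hΛ⟩ : ∃ Λ : ℝ, 0 ≤ Λ ∧ ∀ γ, ‖L γ‖ ≤ Λ :=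
    ⟨∑ γ, ‖L γ‖, Finset.sum_nonneg fun _ _ => norm_nonneg _, fun γ =>
      Finset.single_le_sum (f := fun γ => ‖L γ‖) (fun _ _ => norm_nonneg _) (Finset.mem_univ γ)⟩
  have hm : 0 < m := (Nat.zero_le _).trans_lt hJm
  have hN : 0 < N := a.pos
  -- The minimum is needed because the scale `l` below carries coefficient `1` at the index `a`,
  -- where `q a ≥ c₀` is known, and the actual `q γ` on `J`.
  obtain ⟨c, hc⟩ : ∃ c, c = min c₀ 1 * κ ^ 2 := ⟨_, rfl⟩
  have hc0 : 0 < c := hc ▸ by positivity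
  obtain ⟨A, hA⟩ : ∃ A, A = N * Λ ^ 2 * (K₀ + K₁) := ⟨_, rfl⟩
  obtain ⟨B, hB⟩ : ∃ B, B = N * Λ ^ 2 * (K₀ + K₀ / c₀ * K₀) := ⟨_, rfl⟩
  have hA0 : 0 ≤ A := hA ▸ by positivity
  have hB0 : 0 ≤ B := hB ▸ by positivity
  obtain ⟨I, hI'⟩ : ∃ I, I = ∫ y : EuclideanSpace ℝ (Fin m),
    ‖y‖ ^ m * Real.exp (-c * ‖y‖ ^ 2) := ⟨_, rfl⟩
  have hI : 0 ≤ I := hI' ▸ integral_nonneg fun y => by positivity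
  refine ⟨B * A ^ (m - 1) * I, fun q δ hq0 hqK hδK hqa hJ hz τ hτ => ?_⟩
  obtain ⟨T, hT⟩ : ∃ T, T = τ ^ (2 * m) := ⟨_, rfl⟩
  rw [← hT]
  have hT1 : 1 ≤ T := hT ▸ one_le_pow₀ hτ
  have hT0 : 0 < T := one_pos.trans_le hT1
  -- The scale of the quadratic form in the exponent. It depends on the base point, since the `q γ`
  -- with `γ ∈ J` may be arbitrarily small, but all constants in the final bound do not.
  obtain ⟨l, hl⟩ : ∃ l, l = T ^ ((a : ℕ) + 1) + ∑ γ ∈ J, T ^ ((γ : ℕ) + 1) * q γ := ⟨_, rfl⟩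
  have hsum0 : 0 ≤ ∑ γ ∈ J, T ^ ((γ : ℕ) + 1) * q γ :=
    Finset.sum_nonneg fun γ _ => mul_nonneg (by positivity) (hq0 γ)
  have hTa : T ^ ((a : ℕ) + 1) ≤ l := hl ▸ le_add_of_nonneg_right hsum0
  have hl1 : 1 ≤ l := (one_le_pow₀ hT1).trans hTa
  have hl0 : 0 < l := one_pos.trans_le hl1
  have hJl : ∀ γ ∈ J, T ^ ((γ : ℕ) + 1) * q γ ≤ l := fun γ hγ => by
    have := Finset.single_le_sum (f := fun γ : Fin N => T ^ ((γ : ℕ) + 1) * q γ)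
      (fun γ _ => mul_nonneg (by positivity) (hq0 γ)) hγ
    exact hl ▸ this.trans (le_add_of_nonneg_left (by positivity))
  -- The columns exceed the scale `l` by at most a factor `τ`. For `γ ≤ a` the weight is at most
  -- `T^(a+1)`; for `γ ∈ J` the power bound on `δ γ` is used with `T^(γ+1) ≤ T^N = τ^(2mN)`, which
  -- is why the exponent `2mN` occurs.
  have hδl : ∀ γ : Fin N, T ^ ((γ : ℕ) + 1) * ‖δ γ‖ ≤ (K₀ + K₁) * τ * l := fun γ => by
    by_cases hγa : γ ≤ a
    · have h1 : T ^ ((γ : ℕ) + 1) ≤ l :=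
        (pow_le_pow_right₀ hT1 (Nat.succ_le_succ hγa)).trans hTa
      calc T ^ ((γ : ℕ) + 1) * ‖δ γ‖ ≤ l * K₀ := by gcongr; exact hδK γ
        _ = K₀ * 1 * l := by ring
        _ ≤ (K₀ + K₁) * τ * l := by gcongr; linarith
    · by_cases hγJ : γ ∈ J
      · have h1 : T ^ ((γ : ℕ) + 1) ≤ τ ^ (2 * m * N) := by
          rw [hT, ← pow_mul]
          exact pow_le_pow_right₀ hτ (Nat.mul_le_mul_left _ γ.isLt)
        refine (scaled_le_of_pow_le (by positivity) (hq0 γ) (by positivity) hl1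
          hK₁ (by positivity) h1 (hJl γ hγJ) (hJ γ hγJ)).trans ?_
        gcongr; linarith
      · rw [(hz γ (not_le.1 hγa) hγJ).2, norm_zero, mul_zero]
        positivity
  -- In direction `v` all the ratios `q γ / q a` with `γ ∈ J` are stationary. Cross-multiplication
  -- avoids dividing by `q γ`, which may vanish.
  obtain ⟨v, hv, hvJ⟩ := exists_unit_vector_of_card_lt J hJm fun γ => q a • δ γ - q γ • δ a
  have hqa0 : 0 < q a := hc₀.trans_le hqa
  set μ := δ a v / q a with hμ
  have hδv : ∀ γ, |δ γ v| ≤ K₀ := fun γ => by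
    simpa [hv] using (δ γ).le_of_opNorm_le (hδK γ) v
  have hμK : |μ| ≤ K₀ / c₀ := by
    rw [hμ, abs_div, abs_of_pos hqa0]
    exact div_le_div₀ hK₀ (hδv a) hc₀ hqa
  have key := abs_integral_det_mixedMap_le (fun γ => T ^ ((γ : ℕ) + 1) • δ γ) L
    (fun γ => q γ * T ^ ((γ : ℕ) + 1)) (c := c) (l := l) (K := A * τ * l) (ε := B * T ^ (a : ℕ))
    (μ := μ) hc0 hl0 (by positivity) (by positivity) ?_ ?_ hv ?_
  · rw [← hI'] at key
    refine key.trans ?_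
    have h1 := pow_scale_le (a := (a : ℕ)) hm hτ hT hA0 hB0 hl0 hTa
    calc _ ≤ B * A ^ (m - 1) * τ⁻¹ * I := by gcongr
      _ = _ := by ring
  · intro y
    have hterm : ∀ γ, γ = a ∨ γ ∈ J → κ ^ 2 * ‖y‖ ^ 2 ≤ ‖L γ y‖ ^ 2 := fun γ hγ => by
      rw [← mul_pow]; exact pow_le_pow_left₀ (by positivity) (hL γ hγ y) 2
    have haJ : a ∉ J := fun h => (hJa a h).false
    have hmin : min c₀ 1 ≤ 1 := min_le_right _ _
    have hmin0 : 0 ≤ min c₀ 1 := by positivity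
    calc c * l * ‖y‖ ^ 2
        = min c₀ 1 * T ^ ((a : ℕ) + 1) * (κ ^ 2 * ‖y‖ ^ 2) +
          ∑ γ ∈ J, min c₀ 1 * (T ^ ((γ : ℕ) + 1) * q γ) * (κ ^ 2 * ‖y‖ ^ 2) := by
          rw [← Finset.sum_mul, ← Finset.mul_sum, hl, hc]; ring
      _ ≤ q a * T ^ ((a : ℕ) + 1) * ‖L a y‖ ^ 2 +
          ∑ γ ∈ J, q γ * T ^ ((γ : ℕ) + 1) * ‖L γ y‖ ^ 2 := by
          refine add_le_add ?_ (Finset.sum_le_sum fun γ hγ => ?_)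
          · have := hterm a (Or.inl rfl)
            gcongr
            · exact (min_le_left _ _).trans hqa
          · have := hterm γ (Or.inr hγ)
            have h0 := hq0 γ
            calc min c₀ 1 * (T ^ ((γ : ℕ) + 1) * q γ) * (κ ^ 2 * ‖y‖ ^ 2)
                ≤ 1 * (T ^ ((γ : ℕ) + 1) * q γ) * ‖L γ y‖ ^ 2 := by gcongr
              _ = _ := by ring
      _ = ∑ γ ∈ insert a J, q γ * T ^ ((γ : ℕ) + 1) * ‖L γ y‖ ^ 2 := by
          rw [Finset.sum_insert haJ]
      _ ≤ _ := Finset.sum_le_sum_of_subset_of_nonneg (Finset.subset_univ _) fun γ _ _ => by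
          have := hq0 γ
          positivity
  · intro y u
    rw [mixedMap_apply]
    refine (norm_sum_smul_adjoint_le L hΛ _ (A := (K₀ + K₁) * τ * l * ‖u‖) (fun γ => ?_) y).trans_eq
      (by rw [hA]; ring)
    rw [smul_apply, smul_eq_mul, abs_mul, abs_of_pos (by positivity)]
    calc T ^ ((γ : ℕ) + 1) * |δ γ u| ≤ T ^ ((γ : ℕ) + 1) * (‖δ γ‖ * ‖u‖) := by
          gcongr; exact (δ γ).le_opNorm u
      _ ≤ _ := by
          rw [← mul_assoc]
          exact mul_le_mul_of_nonneg_right (hδl γ) (norm_nonneg _)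
  · intro y
    refine (norm_sum_smul_adjoint_le L hΛ _ (A := (K₀ + K₀ / c₀ * K₀) * T ^ (a : ℕ)) (fun γ => ?_)
      y).trans_eq (by rw [hB]; ring)
    have e : (T ^ ((γ : ℕ) + 1) • δ γ) v - μ * (q γ * T ^ ((γ : ℕ) + 1)) =
        T ^ ((γ : ℕ) + 1) * (δ γ v - μ * q γ) := by
      rw [smul_apply, smul_eq_mul]; ring
    rw [e]
    have hnn : 0 ≤ (K₀ + K₀ / c₀ * K₀) * T ^ (a : ℕ) := by positivity
    -- Only `γ < a` contributes: there `γ + 1 ≤ a`, so the weight is at most `T^a`. For `γ = a` and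
    -- `γ ∈ J` the coefficient vanishes by the choice of `μ` and `v`, and for the other `γ > a`
    -- because `q γ` and `δ γ` are zero.
    rcases lt_trichotomy γ a with h | h | h
    · rw [abs_mul, abs_of_pos (by positivity), mul_comm]
      have h1 : |δ γ v - μ * q γ| ≤ K₀ + K₀ / c₀ * K₀ := by
        refine (abs_sub _ _).trans (add_le_add (hδv γ) ?_)
        rw [abs_mul, abs_of_nonneg (hq0 γ)]
        exact mul_le_mul hμK (hqK γ) (hq0 γ) (by positivity)
      exact mul_le_mul h1 (pow_le_pow_right₀ hT1 h) (by positivity) (by positivity)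
    · subst h
      rw [hμ, div_mul_cancel₀ _ hqa0.ne', sub_self, mul_zero, abs_zero]
      exact hnn
    · by_cases hγJ : γ ∈ J
      · have h2 : q a * δ γ v - q γ * δ a v = 0 := hvJ γ hγJ
        have h3 : δ γ v - μ * q γ = 0 := by
          rw [hμ]; field_simp; linarith
        rw [h3, mul_zero, abs_zero]
        exact hnn
      · obtain ⟨h2, h3⟩ := hz γ h hγJ
        rw [h2, h3, zero_apply, mul_zero, sub_zero, mul_zero, abs_zero]
        exact hnn

end Decay
end FlatCover

namespace FlatCover

/-! ### Integrability and limit over a coordinate neighbourhood -/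

section Density

variable {m N : ℕ}

/-- The density of the Euler form in flat coordinates. -/
noncomputable def density (q : Fin N → EuclideanSpace ℝ (Fin m) → ℝ)
    (L : Fin N → EuclideanSpace ℝ (Fin m) →L[ℝ] EuclideanSpace ℝ (Fin m)) (T : ℝ)
    (z : EuclideanSpace ℝ (Fin m) × EuclideanSpace ℝ (Fin m)) : ℝ :=
  (mixedMap (fun γ => T ^ ((γ : ℕ) + 1) • fderiv ℝ (q γ) z.1) L z.2).det *
    Real.exp (-∑ γ, q γ z.1 * T ^ ((γ : ℕ) + 1) * ‖L γ z.2‖ ^ 2)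

theorem continuousOn_density {q : Fin N → EuclideanSpace ℝ (Fin m) → ℝ}
    (L : Fin N → EuclideanSpace ℝ (Fin m) →L[ℝ] EuclideanSpace ℝ (Fin m)) (T : ℝ)
    {B : Set (EuclideanSpace ℝ (Fin m))} (hB : IsOpen B) (hq : ∀ γ, ContDiffOn ℝ 1 (q γ) B) :
    ContinuousOn (density q L T) (B ×ˢ Set.univ) := by
  have hfst : ContinuousOn (fun z : EuclideanSpace ℝ (Fin m) × EuclideanSpace ℝ (Fin m) => z.1)
      (B ×ˢ Set.univ) := continuous_fst.continuousOn
  have hmaps : Set.MapsTo (fun z : EuclideanSpace ℝ (Fin m) × EuclideanSpace ℝ (Fin m) => z.1)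
      (B ×ˢ Set.univ) B := fun z hz => hz.1
  have hq0 : ∀ γ, ContinuousOn (fun z : EuclideanSpace ℝ (Fin m) × EuclideanSpace ℝ (Fin m) =>
      q γ z.1) (B ×ˢ Set.univ) := fun γ => (hq γ).continuousOn.comp hfst hmaps
  have hq1 : ∀ γ, ContinuousOn (fun z : EuclideanSpace ℝ (Fin m) × EuclideanSpace ℝ (Fin m) =>
      fderiv ℝ (q γ) z.1) (B ×ˢ Set.univ) := fun γ =>
    ((hq γ).continuousOn_fderiv_of_isOpen hB le_rfl).comp hfst hmaps
  refine ContinuousOn.mul ?_ (Real.continuous_exp.comp_continuousOn ?_)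
  · refine ContinuousLinearMap.continuous_det.comp_continuousOn ?_
    refine continuousOn_finsetSum _ fun γ _ => ?_
    have h1 : ContinuousOn (fun z : EuclideanSpace ℝ (Fin m) × EuclideanSpace ℝ (Fin m) =>
      T ^ ((γ : ℕ) + 1) • fderiv ℝ (q γ) z.1) (B ×ˢ Set.univ) :=
      (continuous_const_smul (T ^ ((γ : ℕ) + 1))).comp_continuousOn (hq1 γ)
    have h2 : Continuous (fun z : EuclideanSpace ℝ (Fin m) × EuclideanSpace ℝ (Fin m) =>
      (L γ).adjoint (L γ z.2)) := by fun_prop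
    exact ((ContinuousLinearMap.smulRightL ℝ (EuclideanSpace ℝ (Fin m))
      (EuclideanSpace ℝ (Fin m))).continuous.comp_continuousOn h1).clm_apply h2.continuousOn
  · refine ContinuousOn.neg (continuousOn_finsetSum _ fun γ _ => ?_)
    refine ((hq0 γ).mul continuousOn_const).mul ?_
    exact (by fun_prop : Continuous fun z : EuclideanSpace ℝ (Fin m) × EuclideanSpace ℝ (Fin m) =>
      ‖L γ z.2‖ ^ 2).continuousOn

/-- A crude bound whose constants grow with `T`; it gives absolute integrability for fixed `T` only.
Keeping the single term with index `a` in the exponent already gives a Gaussian. -/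
theorem abs_density_le {q : Fin N → EuclideanSpace ℝ (Fin m) → ℝ}
    {L : Fin N → EuclideanSpace ℝ (Fin m) →L[ℝ] EuclideanSpace ℝ (Fin m)} {T κ c₀ K₀ Λ : ℝ}
    (hT : 0 < T) {a : Fin N} (hκ : 0 ≤ κ) (hΛ : ∀ γ, ‖L γ‖ ≤ Λ)
    (hL : ∀ y, κ * ‖y‖ ≤ ‖L a y‖) {x : EuclideanSpace ℝ (Fin m)} (hq0 : ∀ γ, 0 ≤ q γ x)
    (hqK : ∀ γ, ‖fderiv ℝ (q γ) x‖ ≤ K₀) (hqa : c₀ ≤ q a x)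
    (y : EuclideanSpace ℝ (Fin m)) :
    |density q L T (x, y)| ≤ (N * Λ ^ 2 * ((T + 1) ^ N * K₀)) ^ m *
      (‖y‖ ^ m * Real.exp (-(c₀ * T ^ ((a : ℕ) + 1) * κ ^ 2) * ‖y‖ ^ 2)) := by
  rw [density, abs_mul, abs_of_pos (Real.exp_pos _), ← mul_assoc, ← mul_pow]
  have hK0 : 0 ≤ K₀ := (norm_nonneg _).trans (hqK a)
  refine mul_le_mul (abs_det_le_of_norm_le fun u => ?_) (Real.exp_le_exp.2 ?_) (Real.exp_pos _).le
    (by positivity)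
  · rw [mixedMap_apply]
    refine (norm_sum_smul_adjoint_le L hΛ _ (A := (T + 1) ^ N * K₀ * ‖u‖) (fun γ => ?_) y).trans_eq
      (by ring)
    rw [smul_apply, smul_eq_mul, abs_mul, abs_of_pos (by positivity), mul_assoc]
    refine mul_le_mul ?_ ((fderiv ℝ (q γ) x).le_of_opNorm_le (hqK γ) u) (abs_nonneg _)
      (by positivity)
    exact (pow_le_pow_left₀ hT.le (by linarith) _).trans
      (pow_le_pow_right₀ (by linarith) γ.isLt)
  · have h := Finset.single_le_sum (f := fun γ : Fin N => q γ x * T ^ ((γ : ℕ) + 1) * ‖L γ y‖ ^ 2)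
      (fun γ _ => mul_nonneg (mul_nonneg (hq0 γ) (by positivity)) (by positivity))
      (Finset.mem_univ a)
    have h2 : c₀ * T ^ ((a : ℕ) + 1) * κ ^ 2 * ‖y‖ ^ 2 ≤ q a x * T ^ ((a : ℕ) + 1) * ‖L a y‖ ^ 2 := by
      rw [mul_assoc, ← mul_pow]
      have := pow_le_pow_left₀ (by positivity) (hL y) 2
      have h0 := (hq0 a)
      gcongr
    dsimp only at h ⊢
    linarith

theorem integrableOn_mul_density {q : Fin N → EuclideanSpace ℝ (Fin m) → ℝ}
    {L : Fin N → EuclideanSpace ℝ (Fin m) →L[ℝ] EuclideanSpace ℝ (Fin m)}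
    {B S : Set (EuclideanSpace ℝ (Fin m))} (hB : IsOpen B) (hq : ∀ γ, ContDiffOn ℝ 1 (q γ) B)
    (hS : MeasurableSet S) (hSB : S ⊆ B) (hvol : volume S < ⊤)
    {F : EuclideanSpace ℝ (Fin m) → ℝ} (hF : ContinuousOn F B) {M : ℝ} (hFM : ∀ x ∈ B, |F x| ≤ M)
    {T κ c₀ K₀ : ℝ} (hT : 0 < T) {a : Fin N} (hκ : 0 < κ) (hL : ∀ y, κ * ‖y‖ ≤ ‖L a y‖)
    (hq0 : ∀ x ∈ B, ∀ γ, 0 ≤ q γ x) (hqK : ∀ x ∈ B, ∀ γ, ‖fderiv ℝ (q γ) x‖ ≤ K₀)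
    (hqa : ∀ x ∈ B, c₀ ≤ q a x) (hc₀ : 0 < c₀) :
    IntegrableOn (fun z : EuclideanSpace ℝ (Fin m) × EuclideanSpace ℝ (Fin m) =>
      F z.1 * density q L T z) (S ×ˢ Set.univ) := by
  obtain ⟨Λ, hΛ⟩ : ∃ Λ : ℝ, ∀ γ, ‖L γ‖ ≤ Λ := ⟨∑ γ, ‖L γ‖, fun γ =>
      Finset.single_le_sum (f := fun γ => ‖L γ‖) (fun _ _ => norm_nonneg _) (Finset.mem_univ γ)⟩
  set c := c₀ * T ^ ((a : ℕ) + 1) * κ ^ 2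
  have hc : 0 < c := by positivity
  set K := (N * Λ ^ 2 * ((T + 1) ^ N * K₀)) ^ m
  have hgauss : Integrable fun y : EuclideanSpace ℝ (Fin m) =>
      M * (K * (‖y‖ ^ m * Real.exp (-c * ‖y‖ ^ 2))) := by
    refine (Integrable.const_mul ?_ _).const_mul _
    refine integrable_of_abs_le_gaussian (by fun_prop) hc m (C := 1) fun y => ?_
    rw [abs_of_nonneg (by positivity), one_mul]
    gcongr
    linarith
  have : IsFiniteMeasure (volume.restrict S) := ⟨by simpa using hvol⟩
  have hdom := hgauss.comp_snd (volume.restrict S)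
  have hres : (volume : Measure (EuclideanSpace ℝ (Fin m) × EuclideanSpace ℝ (Fin m))).restrict
      (S ×ˢ Set.univ) = (volume.restrict S).prod volume := by
    rw [Measure.volume_eq_prod, ← Measure.prod_restrict, Measure.restrict_univ]
  rw [IntegrableOn]
  refine Integrable.mono' (hres ▸ hdom) ?_ ?_
  · refine ContinuousOn.aestronglyMeasurable ?_ (hS.prod MeasurableSet.univ)
    refine ContinuousOn.mono ?_ (Set.prod_mono_left hSB)
    exact (hF.comp continuous_fst.continuousOn fun z hz => hz.1).mul
      (continuousOn_density L T hB hq)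
  · refine (ae_restrict_iff' (hS.prod MeasurableSet.univ)).2 (Eventually.of_forall fun z hz => ?_)
    have hx := hSB hz.1
    rw [norm_mul]
    exact mul_le_mul (hFM _ hx) (abs_density_le hT hκ.le hΛ hL (hq0 _ hx) (hqK _ hx) (hqa _ hx)
      z.2) (abs_nonneg _) ((abs_nonneg _).trans (hFM _ hx))

theorem tendsto_setIntegral_mul_density {q : Fin N → EuclideanSpace ℝ (Fin m) → ℝ}
    {L : Fin N → EuclideanSpace ℝ (Fin m) →L[ℝ] EuclideanSpace ℝ (Fin m)}
    {B S : Set (EuclideanSpace ℝ (Fin m))} (hB : IsOpen B) (hq : ∀ γ, ContDiffOn ℝ 1 (q γ) B)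
    (hS : MeasurableSet S) (hSB : S ⊆ B) (hvol : volume S < ⊤)
    {F : EuclideanSpace ℝ (Fin m) → ℝ} (hF : ContinuousOn F B) {M : ℝ} (hFM : ∀ x ∈ B, |F x| ≤ M)
    {κ c₀ K₀ K₁ : ℝ} {a : Fin N} (J : Finset (Fin N)) (hJa : ∀ γ ∈ J, a < γ) (hJm : J.card < m)
    (hκ : 0 < κ) (hL : ∀ γ y, κ * ‖y‖ ≤ ‖L γ y‖)
    (hq0 : ∀ x ∈ B, ∀ γ, 0 ≤ q γ x) (hqK₀ : ∀ x ∈ B, ∀ γ, q γ x ≤ K₀)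
    (hqK : ∀ x ∈ B, ∀ γ, ‖fderiv ℝ (q γ) x‖ ≤ K₀)
    (hqa : ∀ x ∈ B, c₀ ≤ q a x) (hc₀ : 0 < c₀) (hK₀ : 0 ≤ K₀) (hK₁ : 1 ≤ K₁)
    (hJ : ∀ x ∈ B, ∀ γ ∈ J,
      ‖fderiv ℝ (q γ) x‖ ^ (2 * m * N) ≤ K₁ * q γ x ^ (2 * m * N - 1))
    (hz : ∀ x ∈ B, ∀ γ, a < γ → γ ∉ J → q γ x = 0 ∧ fderiv ℝ (q γ) x = 0) :
    Tendsto (fun T : ℝ => ∫ z in S ×ˢ Set.univ, F z.1 * density q L T z) atTop (𝓝 0) := by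
  obtain ⟨C, hC⟩ := exists_abs_integral_det_mixedMap_le L a J hJa hJm hκ hc₀ hK₀ hK₁
    fun γ _ y => hL γ y
  have hm : (0 : ℝ) < 2 * m := by
    have : 0 < m := (Nat.zero_le _).trans_lt hJm
    positivity
  -- The substitution `T = τ^(2m)` of the power counting.
  have hτ : Tendsto (fun T : ℝ => T ^ (1 / (2 * m : ℝ))) atTop atTop :=
    tendsto_rpow_atTop (by positivity)
  have hlim : Tendsto (fun T : ℝ => M * (C * (T ^ (1 / (2 * m : ℝ)))⁻¹) * volume.real S)
      atTop (𝓝 0) := by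
    simpa using ((hτ.inv_tendsto_atTop.const_mul C).const_mul M).mul_const (volume.real S)
  refine squeeze_zero_norm' ?_ hlim
  filter_upwards [eventually_ge_atTop (1 : ℝ)] with T hT
  have hT0 : 0 < T := one_pos.trans_le hT
  have hint := integrableOn_mul_density (T := T) hB hq hS hSB hvol hF hFM hT0 hκ (hL a) hq0
    hqK hqa hc₀
  -- By Fubini the uniform fibre estimate is integrated over a base of finite volume.
  rw [Measure.volume_eq_prod, setIntegral_prod _ hint]
  refine norm_setIntegral_le_of_norm_le_const hvol fun x hx => ?_
  have hxB := hSB hx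
  dsimp only
  rw [Measure.restrict_univ, integral_const_mul, norm_mul]
  refine mul_le_mul (hFM x hxB) ?_ (norm_nonneg _) ((abs_nonneg _).trans (hFM x hxB))
  have hpow : (T ^ (1 / (2 * m : ℝ))) ^ (2 * m) = T := by
    rw [← Real.rpow_natCast, ← Real.rpow_mul hT0.le]
    push_cast
    rw [one_div, inv_mul_cancel₀ hm.ne', Real.rpow_one]
  have := hC (fun γ => q γ x) (fun γ => fderiv ℝ (q γ) x) (hq0 x hxB) (hqK₀ x hxB) (hqK x hxB)
    (hqa x hxB) (hJ x hxB) (hz x hxB) (T ^ (1 / (2 * m : ℝ)))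
    (Real.one_le_rpow hT (by positivity))
  rw [hpow] at this
  exact this

end Density
end FlatCover

namespace FlatCover

/-! ### Weights and boundaries -/

section Weights

variable {n : ℕ} {M : Type*} [TopologicalSpace M] [ChartedSpace (Model n) M]
  [IsManifold (𝓡 (2 * n)) ∞ M]
  {g : ContMDiffRiemannianMetric (𝓡 (2 * n)) ∞ (Model n)
      (fun x : M => TangentSpace (𝓡 (2 * n)) x)} {U : Set M} {r ρ : M → ℝ}

theorem IsNormalGeodesicCoordinate.isLocalDefiningFunction (hr : IsNormalGeodesicCoordinate g U r)
    {p : M} (hp : p ∈ frontier U) : IsLocalDefiningFunction (n := n) U p r := by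
  obtain ⟨O, hO, hfO, hsm, hz, hmem, hgrad⟩ := hr
  have hpO := hfO hp
  refine ⟨(hsm p hpO).contMDiffAt (hO.mem_nhds hpO), hz p hp, fun h0 => ?_,
    eventually_of_mem (hO.mem_nhds hpO) hmem⟩
  obtain ⟨ν, hν, hw⟩ := hgrad p hpO
  have := hw ν
  rw [h0, hν] at this
  simp at this

/-- The support condition gives this only off the closure of `U`. At a boundary point continuity of
`ρ` makes its value the limit of `exp (-1/r²)` from inside, where `r` tends to `0` from above. -/
theorem IsWeight.eq_zero_of_notMem (hρ : IsWeight (n := n) U r ρ) (hU : IsOpen U)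
    (hr : IsNormalGeodesicCoordinate g U r) {x : M} (hx : x ∉ U) : ρ x = 0 := by
  by_cases hc : x ∈ closure U
  · have hf : x ∈ frontier U := ⟨hc, by rwa [hU.interior_eq]⟩
    have hd := hr.isLocalDefiningFunction hf
    have hrc : Tendsto r (𝓝[U] x) (𝓝 0) := by
      have := hd.smooth.continuousAt.tendsto
      rw [hd.zero] at this
      exact this.mono_left nhdsWithin_le_nhds
    have hr0 : Tendsto r (𝓝[U] x) (𝓝[>] 0) := by
      refine tendsto_nhdsWithin_iff.2 ⟨hrc, ?_⟩
      filter_upwards [mem_nhdsWithin_of_mem_nhds hd.mem_iff, self_mem_nhdsWithin] with y hy hyU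
      exact hy.1 hyU
    have h1 : Tendsto (fun y => Real.exp (-1 / r y ^ 2)) (𝓝[U] x) (𝓝 0) := by
      refine Real.tendsto_exp_atBot.comp ?_
      have h2 : Tendsto (fun t : ℝ => -1 / t ^ 2) (𝓝[>] 0) atBot := by
        have h3 : Tendsto (fun t : ℝ => (t⁻¹) ^ 2) (𝓝[>] 0) atTop :=
          (tendsto_pow_atTop two_ne_zero).comp tendsto_inv_nhdsGT_zero
        refine (tendsto_neg_atTop_atBot.comp h3).congr fun t => ?_
        simp [neg_div, inv_pow]
      exact h2.comp hr0
    have h2 : Tendsto ρ (𝓝[U] x) (𝓝 (ρ x)) :=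
      hρ.smooth.continuous.continuousAt.tendsto.mono_left nhdsWithin_le_nhds
    have hne : (𝓝[U] x).NeBot := mem_closure_iff_nhdsWithin_neBot.1 hc
    refine tendsto_nhds_unique h2 (h1.congr' ?_)
    have hev : ∀ᶠ y in 𝓝 x, y ∈ U → ρ y = Real.exp (-1 / r y ^ 2) :=
      hρ.eq_near.filter_mono (nhds_le_nhdsSet hf)
    filter_upwards [mem_nhdsWithin_of_mem_nhds hev, self_mem_nhdsWithin] with y hy hyU
    exact (hy hyU).symm
  · exact image_eq_zero_of_notMem_tsupport fun h => hc (hρ.tsupport_subset h)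

theorem IsWeight.nonneg (hρ : IsWeight (n := n) U r ρ) (hU : IsOpen U)
    (hr : IsNormalGeodesicCoordinate g U r) (x : M) : 0 ≤ ρ x := by
  by_cases hx : x ∈ U
  · exact (hρ.pos x hx).le
  · exact (hρ.eq_zero_of_notMem hU hr hx).ge

/-- The differentials of the `r α` are conormals of the boundaries, hence independent in a cotangent
space of dimension `2n`. -/
theorem ncard_frontier_le {N : ℕ} {U : Fin N → Set M} (hU : IsTransversalFamily (n := n) U)
    {r : Fin N → M → ℝ} (hr : ∀ α, IsNormalGeodesicCoordinate g (U α) (r α)) (p : M) :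
    {α | p ∈ frontier (U α)}.ncard ≤ 2 * n := by
  have h := hU.transversal p r fun α hα => (hr α).isLocalDefiningFunction hα
  have hfin : FiniteDimensional ℝ (Model n →L[ℝ] ℝ) := inferInstance
  have : Fintype ↑{α | p ∈ frontier (U α)} := Fintype.ofFinite _
  have hcard := LinearIndependent.fintype_card_le_finrank
    (R := ℝ) (M := Model n →L[ℝ] ℝ) (b := fun α : ↑{α | p ∈ frontier (U α)} =>
      mvfderiv (𝓡 (2 * n)) (r α) p) h
  have hdim : Module.finrank ℝ (Model n →L[ℝ] ℝ) = 2 * n := by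
    rw [← (LinearMap.toContinuousLinearMap (𝕜 := ℝ) (E := Model n) (F' := ℝ)).finrank_eq,
      Module.finrank_linearMap]
    simp
  rw [hdim] at hcard
  rw [← Nat.card_coe_set_eq, Nat.card_eq_fintype_card]
  exact hcard

end Weights

section Profile

variable {E : Type*} [NormedAddCommGroup E] [NormedSpace ℝ E]

/-- With `t = 1/s²` the derivative of the profile is of size `e^(-t) t^(3/2)`. The even power makes
the exponent of `t` an integer, and one of the `2j + 2` factors `e^(-t)` absorbs `t^(3(j+1))`. -/
theorem exp_neg_inv_sq_pow_le (j : ℕ) {s A : ℝ} (hs : 0 < s) (hA : 0 ≤ A) :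
    (Real.exp (-1 / s ^ 2) * (2 / s ^ 3) * A) ^ (2 * j + 2) ≤
      (2 * A) ^ (2 * j + 2) * (3 * (j + 1)).factorial *
        Real.exp (-1 / s ^ 2) ^ (2 * j + 1) := by
  set t := 1 / s ^ 2 with ht
  have ht0 : 0 < t := by positivity
  have e1 : -1 / s ^ 2 = -t := by rw [ht]; ring
  have hx := Real.pow_div_factorial_le_exp t ht0.le (3 * (j + 1))
  rw [div_le_iff₀' (by positivity)] at hx
  have hs3 : (1 / s ^ 3) ^ (2 * j + 2) = t ^ (3 * (j + 1)) := by
    rw [ht, one_div_pow, one_div_pow, ← pow_mul, ← pow_mul]; ring_nf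
  rw [e1]
  calc (Real.exp (-t) * (2 / s ^ 3) * A) ^ (2 * j + 2)
      = (2 * A) ^ (2 * j + 2) * (1 / s ^ 3) ^ (2 * j + 2) * Real.exp (-t) ^ (2 * j + 2) := by
        rw [← mul_pow, ← mul_pow]; ring
    _ = (2 * A) ^ (2 * j + 2) * (t ^ (3 * (j + 1)) * Real.exp (-t)) * Real.exp (-t) ^ (2 * j + 1) := by
        rw [hs3]; ring
    _ ≤ (2 * A) ^ (2 * j + 2) * (3 * (j + 1)).factorial * Real.exp (-t) ^ (2 * j + 1) := by
        have : t ^ (3 * (j + 1)) * Real.exp (-t) ≤ (3 * (j + 1)).factorial := by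
          rw [Real.exp_neg, ← div_eq_mul_inv, div_le_iff₀ (Real.exp_pos _)]
          exact hx
        gcongr

theorem norm_fderiv_exp_neg_inv_sq_le {q s : E → ℝ} {x : E} (hs : 0 < s x)
    (hsd : DifferentiableAt ℝ s x) (hq : q =ᶠ[𝓝 x] fun y => Real.exp (-1 / s y ^ 2)) :
    ‖fderiv ℝ q x‖ = q x * (2 / s x ^ 3) * ‖fderiv ℝ s x‖ := by
  have h1 : HasFDerivAt (fun y => Real.exp (-1 / s y ^ 2))
      ((Real.exp (-1 / s x ^ 2) * (2 / s x ^ 3)) • fderiv ℝ s x) x := by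
    have h2 : HasDerivAt (fun t : ℝ => Real.exp (-1 / t ^ 2))
        (Real.exp (-1 / s x ^ 2) * (2 / s x ^ 3)) (s x) := by
      have h3 : HasDerivAt (fun t : ℝ => -1 / t ^ 2) (2 / s x ^ 3) (s x) := by
        have := (hasDerivAt_const (s x) (-1 : ℝ)).div (hasDerivAt_pow 2 (s x))
          (pow_ne_zero 2 hs.ne')
        refine HasDerivAt.congr_deriv this ?_
        have hs' := hs.ne'
        push_cast
        field_simp
        norm_num
      exact h3.exp
    exact h2.comp_hasFDerivAt x hsd.hasFDerivAt
  rw [(h1.congr_of_eventuallyEq hq).fderiv, norm_smul, hq.self_of_nhds, Real.norm_of_nonneg]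
  positivity

end Profile
end FlatCover

/-! ### Transition functions between parallel frames -/

namespace FlatCover

theorem coordChangeL_coordChangeL {B V : Type*} {F : B → Type*} [TopologicalSpace B]
    [NormedAddCommGroup V] [NormedSpace ℝ V] [TopologicalSpace (TotalSpace V F)]
    [∀ x, AddCommGroup (F x)] [∀ x, Module ℝ (F x)] [∀ x, TopologicalSpace (F x)]
    (s t u : Trivialization V (TotalSpace.proj : TotalSpace V F → B)) [s.IsLinear ℝ] [t.IsLinear ℝ]
    [u.IsLinear ℝ] {x : B} (hs : x ∈ s.baseSet) (ht : x ∈ t.baseSet) (hu : x ∈ u.baseSet) (w : V) :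
    t.coordChangeL ℝ u x (s.coordChangeL ℝ t x w) = s.coordChangeL ℝ u x w := by
  rw [Trivialization.coordChangeL_apply _ _ ⟨ht, hu⟩, Trivialization.coordChangeL_apply _ _ ⟨hs, ht⟩,
    Trivialization.coordChangeL_apply _ _ ⟨hs, hu⟩, Trivialization.symm_apply_apply_mk _ ht]

section Transition

variable {n N : ℕ} {M : Type*} [TopologicalSpace M] [ChartedSpace (Model n) M]
  {F : M → Type*} [TopologicalSpace (TotalSpace (Model n) F)]
  [∀ x, AddCommGroup (F x)] [∀ x, Module ℝ (F x)] [∀ x, TopologicalSpace (F x)]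
  [∀ x, IsTopologicalAddGroup (F x)] [∀ x, ContinuousSMul ℝ (F x)]
  [FiberBundle (Model n) F]
  {nabla : CovariantDerivative (𝓡 (2 * n)) (Model n) F}
  {φ : Fin N → OpenPartialHomeomorph M (Model n)}
  {e : Fin N → Trivialization (Model n) (TotalSpace.proj : TotalSpace (Model n) F → M)}
  [∀ α, (e α).IsLinear ℝ]

theorem IsFlatTrivialization.contMDiffAt_frame (he : IsFlatTrivialization nabla φ e)
    (α : Fin N) {x : M} (hx : x ∈ (φ α).source) (w : Model n) :
    ContMDiffAt (𝓡 (2 * n)) ((𝓡 (2 * n)).prod 𝓘(ℝ, Model n)) ∞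
      (fun x => TotalSpace.mk' (Model n) x ((e α).symm x w)) x :=
  (he.smooth α w).contMDiffAt ((φ α).open_source.mem_nhds hx)

variable [VectorBundle ℝ (Model n) F]

/-- Leibniz rule with the terms `a k • nabla (σ k)` dropped. Differentiability is carried through
the induction because additivity of `nabla` needs it. -/
theorem covariantDerivative_sum_smul_of_parallel
    (nabla : CovariantDerivative (𝓡 (2 * n)) (Model n) F) {ι : Type*} (s : Finset ι)
    {a : ι → M → ℝ} {σ : ι → ∀ x, F x} {x : M}
    (ha : ∀ k, MDifferentiableAt (𝓡 (2 * n)) 𝓘(ℝ, ℝ) (a k) x)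
    (hσ : ∀ k, MDifferentiableAt (𝓡 (2 * n)) ((𝓡 (2 * n)).prod 𝓘(ℝ, Model n))
      (fun x => TotalSpace.mk' (Model n) x (σ k x)) x)
    (hpar : ∀ k, nabla (σ k) x = 0) :
    MDifferentiableAt (𝓡 (2 * n)) ((𝓡 (2 * n)).prod 𝓘(ℝ, Model n))
      (fun x => TotalSpace.mk' (Model n) x ((∑ k ∈ s, a k • σ k) x)) x ∧
    nabla (∑ k ∈ s, a k • σ k) x =
      ∑ k ∈ s, (mvfderiv (𝓡 (2 * n)) (a k) x).smulRight (σ k x) := by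
  classical
  induction s using Finset.induction_on with
  | empty =>
    simp only [Finset.sum_empty]
    exact ⟨mdifferentiableAt_zeroSection .., by rw [nabla.zero]; rfl⟩
  | insert k s hk ih =>
    have h1 : MDifferentiableAt (𝓡 (2 * n)) ((𝓡 (2 * n)).prod 𝓘(ℝ, Model n))
      (fun x => TotalSpace.mk' (Model n) x ((a k • σ k) x)) x := (ha k).smul_section (hσ k)
    rw [Finset.sum_insert hk, Finset.sum_insert hk]
    refine ⟨mdifferentiableAt_add_section h1 ih.1, ?_⟩
    rw [nabla.isCovariantDerivativeOnUniv.add h1 ih.1, ih.2,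
      nabla.isCovariantDerivativeOnUniv.leibniz (hσ k) (ha k), hpar, smul_zero, zero_add]

variable [ContMDiffVectorBundle ∞ (Model n) F (𝓡 (2 * n))]

/-- The transition from a flat frame to a smooth trivialization is differentiable. -/
theorem IsFlatTrivialization.contMDiffAt_coordChangeL (he : IsFlatTrivialization nabla φ e)
    (α : Fin N) {x : M} (hx : x ∈ (φ α).source) :
    ContMDiffAt (𝓡 (2 * n)) 𝓘(ℝ, Model n →L[ℝ] Model n) ∞
      (fun y => ((e α).coordChangeL ℝ (trivializationAt (Model n) F x) y : Model n →L[ℝ] Model n))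
      x := by
  set t := trivializationAt (Model n) F x
  have hxt : x ∈ t.baseSet := FiberBundle.mem_baseSet_trivializationAt' x
  have h1 : ∀ w, ContMDiffAt (𝓡 (2 * n)) 𝓘(ℝ, Model n) ∞
      (fun y => (t (TotalSpace.mk' (Model n) y ((e α).symm y w))).2) x := fun w =>
    (t.contMDiffAt_section_iff hxt).1 (he.contMDiffAt_frame α hx w)
  have hbase : ∀ᶠ y in 𝓝 x, y ∈ (e α).baseSet ∩ t.baseSet := by
    refine (((e α).open_baseSet.inter t.open_baseSet).mem_nhds ⟨?_, hxt⟩)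
    rw [he.baseSet_eq]; exact hx
  have h2 : ∀ w, ContMDiffAt (𝓡 (2 * n)) 𝓘(ℝ, Model n) ∞
      (fun y => (e α).coordChangeL ℝ t y w) x := fun w => by
    refine (h1 w).congr_of_eventuallyEq ?_
    filter_upwards [hbase] with y hy
    exact (e α).coordChangeL_apply t hy w
  -- `Ψ` assembles an operator from its columns, so that smoothness of the operator-valued map
  -- follows from smoothness on each basis vector.
  let Ψ : (Fin (2 * n) → Model n) →L[ℝ] (Model n →L[ℝ] Model n) :=
    ∑ k, (ContinuousLinearMap.smulRightL ℝ (Model n) (Model n) (EuclideanSpace.proj k)).comp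
      (ContinuousLinearMap.proj k)
  have h3 : (fun y => ((e α).coordChangeL ℝ t y : Model n →L[ℝ] Model n)) = fun y =>
      Ψ fun k => (e α).coordChangeL ℝ t y (EuclideanSpace.single k 1) := by
    funext y
    ext1 w
    conv_lhs => rw [← (EuclideanSpace.basisFun (Fin (2 * n)) ℝ).sum_repr w]
    simp [Ψ, sum_apply]
  rw [h3]
  have h4 : ContMDiffAt (𝓡 (2 * n)) 𝓘(ℝ, Fin (2 * n) → Model n) ∞
      (fun y => fun k => (e α).coordChangeL ℝ t y (EuclideanSpace.single k 1)) x :=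
    contMDiffAt_pi_space.2 fun k => h2 _
  exact Ψ.contMDiff.contMDiffAt.comp x h4

/-- Only the frames of `e α` are known to be smooth, not that `e α` belongs to the smooth atlas of
`F`. The transition is therefore factored through a smooth trivialization, inversion of operators
being smooth. -/
theorem IsFlatTrivialization.contMDiffAt_transition (he : IsFlatTrivialization nabla φ e)
    (α γ : Fin N) {x : M} (hα : x ∈ (φ α).source) (hγ : x ∈ (φ γ).source) (w : Model n) :
    ContMDiffAt (𝓡 (2 * n)) 𝓘(ℝ, Model n) ∞ (fun y => (e α).coordChangeL ℝ (e γ) y w) x := by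
  set t := trivializationAt (Model n) F x
  have hxt : x ∈ t.baseSet := FiberBundle.mem_baseSet_trivializationAt' x
  have h1 := he.contMDiffAt_coordChangeL α hα
  have h2 := he.contMDiffAt_coordChangeL γ hγ
  have h3 : ContMDiffAt (𝓡 (2 * n)) 𝓘(ℝ, Model n →L[ℝ] Model n) ∞ (fun y =>
      ContinuousLinearMap.inverse ((e γ).coordChangeL ℝ t y : Model n →L[ℝ] Model n)) x :=
    (contDiffAt_map_inverse ((e γ).coordChangeL ℝ t x)).contMDiffAt.comp x h2
  have h4 := h3.clm_apply (h1.clm_apply (contMDiffAt_const (c := w)))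
  refine h4.congr_of_eventuallyEq ?_
  have hbase : ∀ᶠ y in 𝓝 x, y ∈ (e α).baseSet ∧ y ∈ (e γ).baseSet ∧ y ∈ t.baseSet := by
    rw [← he.baseSet_eq] at hα hγ
    filter_upwards [(e α).open_baseSet.mem_nhds hα, (e γ).open_baseSet.mem_nhds hγ,
      t.open_baseSet.mem_nhds hxt] with y h1 h2 h3
    exact ⟨h1, h2, h3⟩
  filter_upwards [hbase] with y hy
  rw [ContinuousLinearMap.inverse_equiv, ContinuousLinearEquiv.coe_coe,
    ContinuousLinearEquiv.coe_coe, ContinuousLinearEquiv.eq_symm_apply,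
    coordChangeL_coordChangeL _ _ _ hy.1 hy.2.1 hy.2.2]

/-- The transition functions between flat frames have vanishing differential. -/
theorem IsFlatTrivialization.mvfderiv_transition (he : IsFlatTrivialization nabla φ e)
    (α γ : Fin N) {x : M} (hα : x ∈ (φ α).source) (hγ : x ∈ (φ γ).source) (w : Model n)
    (k : Fin (2 * n)) :
    mvfderiv (𝓡 (2 * n)) (fun y => (e α).coordChangeL ℝ (e γ) y w k) x = 0 := by
  have hbα := hα
  have hbγ := hγ
  rw [← he.baseSet_eq] at hbα hbγ
  let a : Fin (2 * n) → M → ℝ := fun k y => (e α).coordChangeL ℝ (e γ) y w k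
  let σ : Fin (2 * n) → ∀ y, F y := fun k y => (e γ).symm y (EuclideanSpace.single k 1)
  have ha : ∀ k, MDifferentiableAt (𝓡 (2 * n)) 𝓘(ℝ, ℝ) (a k) x := fun k =>
    ((EuclideanSpace.proj k : Model n →L[ℝ] ℝ).contMDiff.contMDiffAt.comp x
      (he.contMDiffAt_transition α γ hα hγ w)).mdifferentiableAt (n := ∞) (by simp)
  have hσ : ∀ k, MDifferentiableAt (𝓡 (2 * n)) ((𝓡 (2 * n)).prod 𝓘(ℝ, Model n))
      (fun x => TotalSpace.mk' (Model n) x (σ k x)) x := fun k =>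
    (he.contMDiffAt_frame γ hγ _).mdifferentiableAt (by simp)
  obtain ⟨hd, hn⟩ := covariantDerivative_sum_smul_of_parallel nabla Finset.univ ha hσ
    fun k => he.parallel γ _ x hγ
  -- A section of the frame `α` expanded in the frame `γ`. Both are parallel, so `∑ da_k ⊗ σ_k = 0`,
  -- and the trivialization `e γ` reads off each `da_k`.
  have hsum : ∀ᶠ y in 𝓝 x, (e α).symm y w = (∑ k, a k • σ k) y := by
    filter_upwards [(e α).open_baseSet.mem_nhds hbα, (e γ).open_baseSet.mem_nhds hbγ] with y h1 h2
    have h3 := (e γ).symm_apply_apply_mk h2 ((e α).symm y w)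
    rw [← Trivialization.coordChangeL_apply _ _ ⟨h1, h2⟩ (R := ℝ)] at h3
    rw [← h3, ← Trivialization.symmₗ_apply (R := ℝ) _ h2]
    conv_lhs => rw [← (EuclideanSpace.basisFun (Fin (2 * n)) ℝ).sum_repr
      ((e α).coordChangeL ℝ (e γ) y w)]
    rw [map_sum, Finset.sum_apply]
    refine Finset.sum_congr rfl fun k _ => ?_
    rw [map_smul, Trivialization.symmₗ_apply (R := ℝ) _ h2]
    simp [a, σ]
  have hzero : nabla (∑ k, a k • σ k) x = 0 := by
    rw [← he.parallel α w x hα]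
    exact (nabla.isCovariantDerivativeOnUniv.congr_of_eventuallyEq
      ((he.contMDiffAt_frame α hα w).mdifferentiableAt (by simp)) hd univ_mem hsum).symm
  rw [hzero] at hn
  ext u
  have h4 := congrArg (fun A : TangentSpace (𝓡 (2 * n)) x →L[ℝ] F x => (e γ).linearMapAt ℝ x (A u)) hn
  have h5 : ∀ k, (e γ).linearMapAt ℝ x (σ k x) = EuclideanSpace.single k 1 := fun k =>
    Trivialization.linearMapAt_symm (R := ℝ) _ hbγ _
  simp only [sum_apply, ContinuousLinearMap.smulRight_apply, map_sum, map_smul, h5, zero_apply,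
    map_zero] at h4
  have h6 := congrArg (fun z : Model n => z k) h4
  simpa [a, PiLp.single_apply, Pi.single_apply] using h6.symm

end Transition
end FlatCover

namespace FlatCover

/-! ### Locally constant functions up to a smooth boundary -/

section HalfSpace

variable {E X : Type*} [NormedAddCommGroup E] [NormedSpace ℝ E]

/-- A function that is constant on the convex subsets of a set with smooth boundary is constant on
this set near each boundary point. -/
theorem exists_eventually_eq_of_convex_of_boundary {D : Set E} {s : E → ℝ} {f : E → X} {x₀ : E}
    (hs : ContDiffAt ℝ 1 s x₀) (h0 : s x₀ = 0) (hd : fderiv ℝ s x₀ ≠ 0)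
    (hD : ∀ᶠ x in 𝓝 x₀, x ∈ D ↔ 0 < s x)
    (hf : ∀ C : Set E, Convex ℝ C → C ⊆ D → ∀ x ∈ C, ∀ y ∈ C, f x = f y) :
    ∃ z ∈ D, ∀ᶠ x in 𝓝 x₀, x ∈ D → f x = f z := by
  obtain ⟨v, hv⟩ : ∃ v, 0 < fderiv ℝ s x₀ v := by
    obtain ⟨u, hu⟩ : ∃ u, fderiv ℝ s x₀ u ≠ 0 := by
      by_contra! h
      exact hd (ContinuousLinearMap.ext h)
    rcases hu.lt_or_gt with h | h
    · exact ⟨-u, by simpa using h⟩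
    · exact ⟨u, h⟩
  have hpos : ∀ᶠ x in 𝓝 x₀, 0 < fderiv ℝ s x v := by
    have hc : ContinuousAt (fun x => fderiv ℝ s x v) x₀ :=
      (hs.continuousAt_fderiv one_ne_zero).clm_apply continuousAt_const
    exact hc.eventually_const_lt hv
  have hdiff : ∀ᶠ x in 𝓝 x₀, DifferentiableAt ℝ s x := by
    filter_upwards [hs.eventually (by simp)] with x hx
    exact hx.differentiableAt one_ne_zero
  obtain ⟨ε, hε, hball⟩ := Metric.eventually_nhds_iff_ball.1 ((hD.and hpos).and hdiff)
  -- Near `x₀` the defining function increases along `v`, so moving in this direction does not leave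
  -- `D`.
  have hmono : ∀ (t : ℝ) (x : E), 0 < t → (∀ τ ∈ Set.Icc 0 t, x + τ • v ∈ Metric.ball x₀ ε) →
      ∀ τ ∈ Set.Icc 0 t, s x ≤ s (x + τ • v) ∧ (0 < τ → s x < s (x + τ • v)) := by
    intro t x ht hx τ hτ
    have hder : ∀ τ ∈ Set.Icc 0 t, HasDerivAt (fun τ : ℝ => s (x + τ • v))
        (fderiv ℝ s (x + τ • v) v) τ := fun τ hτ => by
      have h1 : HasDerivAt (fun τ : ℝ => x + τ • v) v τ := by
        simpa using ((hasDerivAt_id τ).smul_const v).const_add x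
      exact (hball _ (hx τ hτ)).2.hasFDerivAt.comp_hasDerivAt τ h1
    have hsm : StrictMonoOn (fun τ : ℝ => s (x + τ • v)) (Set.Icc 0 t) := by
      refine strictMonoOn_of_deriv_pos (convex_Icc 0 t)
        (fun τ hτ => (hder τ hτ).continuousAt.continuousWithinAt) fun τ hτ => ?_
      have hτ' := interior_subset hτ
      rw [(hder τ hτ').deriv]
      exact (hball _ (hx τ hτ')).1.2
    have h00 : (0 : ℝ) ∈ Set.Icc 0 t := ⟨le_rfl, ht.le⟩
    constructor
    · simpa using hsm.monotoneOn h00 hτ hτ.1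
    · intro hτ0
      simpa using hsm h00 hτ hτ0
  obtain ⟨t, ht, htv⟩ : ∃ t : ℝ, 0 < t ∧ t * ‖v‖ < ε / 2 := by
    refine ⟨ε / 2 / (‖v‖ + 1), by positivity, ?_⟩
    rw [div_mul_eq_mul_div, div_lt_iff₀ (by positivity)]
    exact mul_lt_mul_of_pos_left (lt_add_one _) (by positivity)
  have hseg : ∀ x ∈ Metric.ball x₀ (ε / 2), ∀ τ ∈ Set.Icc 0 t, x + τ • v ∈ Metric.ball x₀ ε := by
    intro x hx τ hτ
    rw [mem_ball_iff_norm] at hx ⊢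
    calc ‖x + τ • v - x₀‖ = ‖(x - x₀) + τ • v‖ := by congr 1; abel
      _ ≤ ‖x - x₀‖ + ‖τ • v‖ := norm_add_le _ _
      _ < ε / 2 + ε / 2 := by
          refine add_lt_add_of_lt_of_le hx ?_
          rw [norm_smul, Real.norm_of_nonneg hτ.1]
          exact (mul_le_mul_of_nonneg_right hτ.2 (norm_nonneg v)).trans htv.le
      _ = ε := add_halves ε
  have htt : t ∈ Set.Icc 0 t := ⟨ht.le, le_rfl⟩
  have hx0 : x₀ ∈ Metric.ball x₀ (ε / 2) := Metric.mem_ball_self (half_pos hε)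
  -- An interior reference point. A point `x ∈ D` near `x₀` is joined to `x + t • v` by a segment in
  -- `D`, and this endpoint lies in a ball around `z` contained in `D`; both sets are convex.
  set z := x₀ + t • v with hz
  have hzball : z ∈ Metric.ball x₀ ε := hseg x₀ hx0 t htt
  have hsz : 0 < s z := by
    have := (hmono t x₀ ht (hseg x₀ hx0) t htt).2 ht
    rwa [h0] at this
  have hzev : ∀ᶠ y in 𝓝 z, 0 < s y ∧ y ∈ Metric.ball x₀ ε :=
    ((hball z hzball).2.continuousAt.eventually_const_lt hsz).and
      (Metric.isOpen_ball.mem_nhds hzball)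
  obtain ⟨ε', hε', hball'⟩ := Metric.eventually_nhds_iff_ball.1 hzev
  refine ⟨z, (hball z hzball).1.1.2 hsz, ?_⟩
  filter_upwards [Metric.ball_mem_nhds x₀ (half_pos hε), Metric.ball_mem_nhds x₀ hε'] with x h1 h2 hxD
  have hsx : 0 < s x := (hball x (Metric.ball_subset_ball (by linarith) h1)).1.1.1 hxD
  have e1 : f x = f (x + t • v) := by
    refine hf (segment ℝ x (x + t • v)) (convex_segment _ _) ?_ x (left_mem_segment _ _ _) _
      (right_mem_segment _ _ _)
    intro y hy
    rw [segment_eq_image'] at hy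
    obtain ⟨θ, hθ, rfl⟩ := hy
    have hθt : θ * t ∈ Set.Icc 0 t :=
      ⟨mul_nonneg hθ.1 ht.le, mul_le_of_le_one_left ht.le hθ.2⟩
    have hy' : x + θ • (x + t • v - x) = x + (θ * t) • v := by
      rw [add_sub_cancel_left, smul_smul]
    simp only [hy']
    exact (hball _ (hseg x h1 _ hθt)).1.1.2
      (hsx.trans_le (hmono t x ht (hseg x h1) _ hθt).1)
  have e2 : f (x + t • v) = f z := by
    refine hf (Metric.ball z ε') (convex_ball _ _) ?_ _ ?_ z (Metric.mem_ball_self hε')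
    · intro y hy
      exact (hball y (hball' y hy).2).1.1.2 (hball' y hy).1
    · rw [mem_ball_iff_norm] at h2 ⊢
      rwa [hz, add_sub_add_right_eq_sub]
  rw [e1, e2]

end HalfSpace

/-! ### Constancy of the transition functions in a chart -/

section LocalCoordinates

variable {n N : ℕ} {M : Type*} [TopologicalSpace M] [ChartedSpace (Model n) M]
  {φ : Fin N → OpenPartialHomeomorph M (Model n)}

theorem IsOrientedAtlas.contDiffAt_comp_symm (hφ : IsOrientedAtlas φ) (α : Fin N) {h : M → ℝ}
    {x : Model n} (hx : x ∈ (φ α).target)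
    (hh : ContMDiffAt (𝓡 (2 * n)) 𝓘(ℝ, ℝ) ∞ h ((φ α).symm x)) :
    ContDiffAt ℝ ∞ (fun x => h ((φ α).symm x)) x := by
  rw [← contMDiffAt_iff_contDiffAt]
  exact hh.comp x ((contMDiffOn_symm_of_mem_maximalAtlas (hφ.smooth α)).contMDiffAt
    ((φ α).open_target.mem_nhds hx))

theorem IsOrientedAtlas.contDiffOn_comp_symm (hφ : IsOrientedAtlas φ) (α : Fin N) {h : M → ℝ}
    (hh : ContMDiff (𝓡 (2 * n)) 𝓘(ℝ, ℝ) ∞ h) :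
    ContDiffOn ℝ ∞ (fun x => h ((φ α).symm x)) (φ α).target := fun _ hx =>
  (hφ.contDiffAt_comp_symm α hx hh.contMDiffAt).contDiffWithinAt

theorem IsOrientedAtlas.fderiv_comp_symm_ne_zero [IsManifold (𝓡 (2 * n)) ∞ M]
    (hφ : IsOrientedAtlas φ) (α : Fin N) {h : M → ℝ} {p : M} (hp : p ∈ (φ α).source) (hh : ContMDiffAt (𝓡 (2 * n)) 𝓘(ℝ, ℝ) ∞ h p)
    (hd : mvfderiv (𝓡 (2 * n)) h p ≠ 0) :
    fderiv ℝ (fun x => h ((φ α).symm x)) (φ α p) ≠ 0 := by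
  intro h0
  have h1 : HasMFDerivAt (𝓡 (2 * n)) 𝓘(ℝ, ℝ) (fun x => h ((φ α).symm x)) (φ α p) 0 := by
    have hh0 : HasFDerivAt (fun x => h ((φ α).symm x)) (0 : Model n →L[ℝ] ℝ) (φ α p) := by
      rw [← h0]
      refine ((hφ.contDiffAt_comp_symm α ((φ α).map_source hp) ?_).differentiableAt
        (by simp)).hasFDerivAt
      rwa [(φ α).left_inv hp]
    exact hh0.hasMFDerivAt
  have h2 : MDifferentiableAt (𝓡 (2 * n)) (𝓡 (2 * n)) (φ α) p :=
    (contMDiffAt_of_mem_maximalAtlas (hφ.smooth α) hp).mdifferentiableAt (by simp)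
  have h3 := h1.comp p h2.hasMFDerivAt
  have h4 : HasMFDerivAt (𝓡 (2 * n)) 𝓘(ℝ, ℝ) h p (0 : TangentSpace (𝓡 (2 * n)) p →L[ℝ] ℝ) := by
    refine (h3.congr_of_eventuallyEq ?_).congr_mfderiv ?_
    · filter_upwards [(φ α).open_source.mem_nhds hp] with y hy
      simp [(φ α).left_inv hy]
    · ext; rfl
  apply hd
  rw [mvfderiv, h4.mfderiv]
  ext; rfl

variable
  {F : M → Type*} [TopologicalSpace (TotalSpace (Model n) F)]
  [∀ x, AddCommGroup (F x)] [∀ x, Module ℝ (F x)] [∀ x, TopologicalSpace (F x)]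
  [∀ x, IsTopologicalAddGroup (F x)] [∀ x, ContinuousSMul ℝ (F x)]
  [FiberBundle (Model n) F]
  [VectorBundle ℝ (Model n) F] [ContMDiffVectorBundle ∞ (Model n) F (𝓡 (2 * n))]
  {nabla : CovariantDerivative (𝓡 (2 * n)) (Model n) F}
  {e : Fin N → Trivialization (Model n) (TotalSpace.proj : TotalSpace (Model n) F → M)}
  [∀ α, (e α).IsLinear ℝ]

/-- The transition functions between flat frames are constant on convex sets. -/
theorem IsFlatTrivialization.transition_eq_of_convex (he : IsFlatTrivialization nabla φ e)
    (hφ : IsOrientedAtlas φ) (α γ : Fin N) {C : Set (Model n)} (hC : Convex ℝ C)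
    (hCt : C ⊆ (φ α).target ∩ (φ α).symm ⁻¹' (φ γ).source) {x y : Model n} (hx : x ∈ C)
    (hy : y ∈ C) :
    (e α).coordChangeL ℝ (e γ) ((φ α).symm x) = (e α).coordChangeL ℝ (e γ) ((φ α).symm y) := by
  ext w k
  have hder : ∀ z ∈ C, HasFDerivAt
      (fun z => (e α).coordChangeL ℝ (e γ) ((φ α).symm z) w k) (0 : Model n →L[ℝ] ℝ) z := by
    intro z hz
    obtain ⟨hzt, hzγ⟩ := hCt hz
    have hzα := (φ α).map_target hzt
    have h1 : ContMDiffAt (𝓡 (2 * n)) 𝓘(ℝ, ℝ) ∞ (fun q => (e α).coordChangeL ℝ (e γ) q w k)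
        ((φ α).symm z) :=
      (EuclideanSpace.proj k : Model n →L[ℝ] ℝ).contMDiff.contMDiffAt.comp _
        (he.contMDiffAt_transition α γ hzα hzγ w)
    have h2 := (h1.mdifferentiableAt (by simp)).hasMFDerivAt
    have h3 : mfderiv (𝓡 (2 * n)) 𝓘(ℝ, ℝ) (fun q => (e α).coordChangeL ℝ (e γ) q w k)
        ((φ α).symm z) = 0 := by
      have := he.mvfderiv_transition α γ hzα hzγ w k
      ext u
      exact congrArg (fun A : TangentSpace (𝓡 (2 * n)) ((φ α).symm z) →L[ℝ] ℝ => A u) this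
    rw [h3] at h2
    have h4 : MDifferentiableAt (𝓡 (2 * n)) (𝓡 (2 * n)) (φ α).symm z :=
      ((contMDiffOn_symm_of_mem_maximalAtlas (hφ.smooth α)).contMDiffAt
        ((φ α).open_target.mem_nhds hzt)).mdifferentiableAt (by simp)
    have h5 := h2.comp z h4.hasMFDerivAt
    rw [ContinuousLinearMap.zero_comp] at h5
    exact hasMFDerivAt_iff_hasFDerivAt.1 h5
  -- Mean value inequality with derivative bound zero.
  have hnorm := hC.norm_image_sub_le_of_norm_hasFDerivWithin_le (C := 0)
    (fun z hz => (hder z hz).hasFDerivWithinAt) (fun z _ => by simp) hy hx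
  rw [zero_mul] at hnorm
  exact sub_eq_zero.1 (norm_le_zero_iff.1 hnorm)

/-- Near a point of the closure of `U γ` the transition function to the flat frame over `U γ` is
constant. -/
theorem IsFlatTrivialization.exists_transition_eq [IsManifold (𝓡 (2 * n)) ∞ M]
    (he : IsFlatTrivialization nabla φ e)
    (hφ : IsOrientedAtlas φ) {g : ContMDiffRiemannianMetric (𝓡 (2 * n)) ∞ (Model n)
      (fun x : M => TangentSpace (𝓡 (2 * n)) x)} {r : M → ℝ} {α γ : Fin N}
    (hr : IsNormalGeodesicCoordinate g (φ γ).source r) {p : M} (hp : p ∈ (φ α).source)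
    (hpγ : p ∈ closure (φ γ).source) :
    ∃ q ∈ (φ α).source ∩ (φ γ).source, ∀ᶠ x in 𝓝 (φ α p), (φ α).symm x ∈ (φ γ).source →
      (e α).coordChangeL ℝ (e γ) ((φ α).symm x) = (e α).coordChangeL ℝ (e γ) q := by
  have hpt := (φ α).map_source hp
  have htarget : ∀ᶠ x in 𝓝 (φ α p), x ∈ (φ α).target := (φ α).open_target.mem_nhds hpt
  by_cases hpU : p ∈ (φ γ).source
  · have hopen := (φ α).symm.isOpen_inter_preimage (φ γ).open_source
    obtain ⟨ε, hε, hball⟩ := Metric.isOpen_iff.1 hopen (φ α p) ⟨hpt, by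
      simpa [(φ α).left_inv hp] using hpU⟩
    refine ⟨p, ⟨hp, hpU⟩, ?_⟩
    filter_upwards [Metric.ball_mem_nhds _ hε] with x hx _
    have := he.transition_eq_of_convex hφ α γ (convex_ball _ _) hball hx (Metric.mem_ball_self hε)
    rwa [(φ α).left_inv hp] at this
  · have hpf : p ∈ frontier (φ γ).source := ⟨hpγ, by rwa [(φ γ).open_source.interior_eq]⟩
    have hd := hr.isLocalDefiningFunction hpf
    have hcont : Tendsto (φ α).symm (𝓝 (φ α p)) (𝓝 p) := (φ α).tendsto_symm hp
    obtain ⟨z, hz, hev⟩ := exists_eventually_eq_of_convex_of_boundary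
      (D := (φ α).target ∩ (φ α).symm ⁻¹' (φ γ).source) (s := fun x => r ((φ α).symm x))
      (f := fun x => (e α).coordChangeL ℝ (e γ) ((φ α).symm x)) (x₀ := φ α p)
      ((hφ.contDiffAt_comp_symm α hpt (by rw [(φ α).left_inv hp]; exact hd.smooth)).of_le (by simp))
      (by rw [(φ α).left_inv hp]; exact hd.zero)
      (hφ.fderiv_comp_symm_ne_zero α hp hd.smooth hd.deriv_ne_zero)
      (by
        filter_upwards [hcont.eventually hd.mem_iff, htarget] with x hx hxt
        exact ⟨fun h => hx.1 h.2, fun h => ⟨hxt, hx.2 h⟩⟩)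
      (fun C hC hCD x hx y hy => he.transition_eq_of_convex hφ α γ hC hCD hx hy)
    refine ⟨(φ α).symm z, ⟨(φ α).map_target hz.1, hz.2⟩, ?_⟩
    filter_upwards [hev, htarget] with x hx hxt hxγ
    exact hx ⟨hxt, hxγ⟩

end LocalCoordinates
end FlatCover

/-! ### Estimates near a point in a chart -/

namespace FlatCover

/-- Formulated for all small `κ`, so that one `κ` can be chosen for finitely many maps; the bounds
below hold for all large constants for the same reason. -/
theorem ContinuousLinearEquiv.eventually_mul_norm_le {E E' : Type*} [NormedAddCommGroup E]
    [NormedSpace ℝ E] [NormedAddCommGroup E'] [NormedSpace ℝ E'] (L : E ≃L[ℝ] E') :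
    ∀ᶠ κ : ℝ in 𝓝[>] 0, ∀ y, κ * ‖y‖ ≤ ‖L y‖ := by
  have h1 : Tendsto (fun κ : ℝ => κ * ‖(L.symm : E' →L[ℝ] E)‖) (𝓝[>] 0) (𝓝 0) := by
    have : Tendsto (fun κ : ℝ => κ * ‖(L.symm : E' →L[ℝ] E)‖) (𝓝 0)
        (𝓝 (0 * ‖(L.symm : E' →L[ℝ] E)‖)) := tendsto_id.mul_const _
    rw [zero_mul] at this
    exact this.mono_left nhdsWithin_le_nhds
  filter_upwards [h1.eventually_lt_const one_pos, self_mem_nhdsWithin] with κ hκ hκ0 y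
  have hκ0' : 0 < κ := hκ0
  calc κ * ‖y‖ = κ * ‖(L.symm : E' →L[ℝ] E) (L y)‖ := by simp
    _ ≤ κ * (‖(L.symm : E' →L[ℝ] E)‖ * ‖L y‖) := by
        gcongr; exact ContinuousLinearMap.le_opNorm _ _
    _ = (κ * ‖(L.symm : E' →L[ℝ] E)‖) * ‖L y‖ := (mul_assoc _ _ _).symm
    _ ≤ ‖L y‖ := mul_le_of_le_one_left (norm_nonneg _) hκ.le

section LocalEstimates

variable {n N : ℕ} {M : Type*} [TopologicalSpace M] [ChartedSpace (Model n) M]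
  {φ : Fin N → OpenPartialHomeomorph M (Model n)} {U : Set M} {r ρ : M → ℝ} {p : M} {α : Fin N}

theorem IsWeight.eventually_eq_zero (hρ : IsWeight (n := n) U r ρ) (hp : p ∈ (φ α).source)
    (hpU : p ∉ closure U) :
    ∀ᶠ x in 𝓝 (φ α p), ρ ((φ α).symm x) = 0 ∧ fderiv ℝ (fun x => ρ ((φ α).symm x)) x = 0 := by
  have hcont : Tendsto (φ α).symm (𝓝 (φ α p)) (𝓝 p) := (φ α).tendsto_symm hp
  have h0 : ∀ᶠ x in 𝓝 (φ α p), ρ ((φ α).symm x) = 0 := by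
    refine hcont.eventually (p := fun x => ρ x = 0) ?_
    filter_upwards [isClosed_closure.isOpen_compl.mem_nhds hpU] with x hx
    exact image_eq_zero_of_notMem_tsupport fun h => hx (hρ.tsupport_subset h)
  filter_upwards [h0.eventually_nhds] with x hx
  refine ⟨hx.self_of_nhds, ?_⟩
  have : (fun x => ρ ((φ α).symm x)) =ᶠ[𝓝 x] fun _ => (0 : ℝ) := hx
  rw [this.fderiv_eq]
  simp

theorem IsWeight.eventually_le (hρ : IsWeight (n := n) U r ρ) (hφ : IsOrientedAtlas φ)
    (hp : p ∈ (φ α).source) :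
    ∀ᶠ K : ℝ in atTop, ∀ᶠ x in 𝓝 (φ α p), ρ ((φ α).symm x) ≤ K ∧
      ‖fderiv ℝ (fun x => ρ ((φ α).symm x)) x‖ ≤ K := by
  have hs : ContDiffAt ℝ ∞ (fun x => ρ ((φ α).symm x)) (φ α p) :=
    hφ.contDiffAt_comp_symm α ((φ α).map_source hp) hρ.smooth.contMDiffAt
  filter_upwards [eventually_gt_atTop (ρ ((φ α).symm (φ α p))),
    eventually_gt_atTop ‖fderiv ℝ (fun x => ρ ((φ α).symm x)) (φ α p)‖] with K h1 h2
  filter_upwards [hs.continuousAt.eventually_lt_const h1,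
    (hs.continuousAt_fderiv (by simp)).norm.eventually_lt_const h2] with x h3 h4
  exact ⟨h3.le, h4.le⟩

theorem IsWeight.exists_pos_eventually_le (hρ : IsWeight (n := n) U r ρ)
    (hp : p ∈ (φ α).source) (hpU : p ∈ U) :
    ∃ c > 0, ∀ᶠ x in 𝓝 (φ α p), c ≤ ρ ((φ α).symm x) := by
  have hcont : Tendsto (φ α).symm (𝓝 (φ α p)) (𝓝 p) := (φ α).tendsto_symm hp
  refine ⟨ρ p / 2, half_pos (hρ.pos p hpU), hcont.eventually (p := fun x => ρ p / 2 ≤ ρ x) ?_⟩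
  filter_upwards [hρ.smooth.continuous.continuousAt.eventually_const_lt
    (half_lt_self (hρ.pos p hpU))] with x hx
  exact hx.le

variable [IsManifold (𝓡 (2 * n)) ∞ M]
  {g : ContMDiffRiemannianMetric (𝓡 (2 * n)) ∞ (Model n)
      (fun x : M => TangentSpace (𝓡 (2 * n)) x)}

/-- Near a boundary point of `U`, the differential of a weight is controlled by a power of the
weight that is as close to one as one likes. -/
theorem IsWeight.eventually_norm_fderiv_pow_le (hρ : IsWeight (n := n) U r ρ) (hU : IsOpen U)
    (hr : IsNormalGeodesicCoordinate g U r) (hφ : IsOrientedAtlas φ) (hp : p ∈ (φ α).source)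
    (hpU : p ∈ frontier U) (j : ℕ) :
    ∀ᶠ K : ℝ in atTop, ∀ᶠ x in 𝓝 (φ α p),
      ‖fderiv ℝ (fun x => ρ ((φ α).symm x)) x‖ ^ (2 * j + 2) ≤
        K * ρ ((φ α).symm x) ^ (2 * j + 1) := by
  have hpt := (φ α).map_source hp
  have hd := hr.isLocalDefiningFunction hpU
  have hcont : Tendsto (φ α).symm (𝓝 (φ α p)) (𝓝 p) := (φ α).tendsto_symm hp
  have htarget : ∀ᶠ x in 𝓝 (φ α p), x ∈ (φ α).target := (φ α).open_target.mem_nhds hpt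
  set s : Model n → ℝ := fun x => r ((φ α).symm x)
  have hs : ContDiffAt ℝ ∞ s (φ α p) :=
    hφ.contDiffAt_comp_symm α hpt (by rw [(φ α).left_inv hp]; exact hd.smooth)
  obtain ⟨A, hA⟩ : ∃ A : ℝ, ‖fderiv ℝ s (φ α p)‖ < A := exists_gt _
  have hA0 : 0 ≤ A := (norm_nonneg _).trans hA.le
  have hsA : ∀ᶠ x in 𝓝 (φ α p), ‖fderiv ℝ s x‖ < A :=
    (hs.continuousAt_fderiv (by simp)).norm.eventually_lt_const hA
  have hsd : ∀ᶠ x in 𝓝 (φ α p), DifferentiableAt ℝ s x := by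
    filter_upwards [(hs.of_le (m := 1) (by simp)).eventually (by simp)] with x hx
    exact hx.differentiableAt one_ne_zero
  have heq : ∀ᶠ x in 𝓝 (φ α p), (φ α).symm x ∈ U →
      ρ ((φ α).symm x) = Real.exp (-1 / s x ^ 2) :=
    hcont.eventually (hρ.eq_near.filter_mono (nhds_le_nhdsSet hpU))
  filter_upwards [eventually_ge_atTop ((2 * A) ^ (2 * j + 2) * (3 * (j + 1)).factorial)] with K hK
  filter_upwards [htarget, hsA, hsd, heq.eventually_nhds, hcont.eventually hd.mem_iff]
    with x hxt hxA hxd hxeq hxU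
  have hK0 : 0 ≤ K := le_trans (by positivity) hK
  have hρ0 := hρ.nonneg hU hr ((φ α).symm x)
  by_cases hx : (φ α).symm x ∈ U
  · have hsx : 0 < s x := hxU.1 hx
    have hq : (fun x => ρ ((φ α).symm x)) =ᶠ[𝓝 x] fun y => Real.exp (-1 / s y ^ 2) := by
      filter_upwards [hxeq, ((φ α).continuousAt_symm hxt).preimage_mem_nhds (hU.mem_nhds hx)]
        with y h1 h2
      exact h1 h2
    rw [norm_fderiv_exp_neg_inv_sq_le hsx hxd hq, hxeq.self_of_nhds hx]
    calc _ ≤ (Real.exp (-1 / s x ^ 2) * (2 / s x ^ 3) * A) ^ (2 * j + 2) := by gcongr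
      _ ≤ _ := exp_neg_inv_sq_pow_le j hsx hA0
      _ ≤ _ := by gcongr
  -- Outside `U` the nonnegative weight attains its minimum zero, so its differential vanishes as
  -- well.
  · have h0 : ρ ((φ α).symm x) = 0 := hρ.eq_zero_of_notMem hU hr hx
    have hmin : IsLocalMin (fun x => ρ ((φ α).symm x)) x :=
      Eventually.of_forall fun y => by
        simp only [h0]; exact hρ.nonneg hU hr _
    rw [hmin.fderiv_eq_zero, norm_zero, zero_pow (by omega)]
    positivity

variable
  {F : M → Type*} [TopologicalSpace (TotalSpace (Model n) F)]
  [∀ x, AddCommGroup (F x)] [∀ x, Module ℝ (F x)] [∀ x, TopologicalSpace (F x)]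
  [∀ x, IsTopologicalAddGroup (F x)] [∀ x, ContinuousSMul ℝ (F x)]
  [FiberBundle (Model n) F]
  [VectorBundle ℝ (Model n) F] [ContMDiffVectorBundle ∞ (Model n) F (𝓡 (2 * n))]
  {nabla : CovariantDerivative (𝓡 (2 * n)) (Model n) F}
  {e : Fin N → Trivialization (Model n) (TotalSpace.proj : TotalSpace (Model n) F → M)}
  [∀ α, (e α).IsLinear ℝ]

theorem IsFlatTrivialization.exists_eventually_transition_eq
    (he : IsFlatTrivialization nabla φ e) (hφ : IsOrientedAtlas φ) {r : Fin N → M → ℝ}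
    (hr : ∀ γ, IsNormalGeodesicCoordinate g (φ γ).source (r γ)) (hp : p ∈ (φ α).source) :
    ∃ L : Fin N → Model n ≃L[ℝ] Model n, ∀ᶠ x in 𝓝 (φ α p), ∀ γ,
      (φ α).symm x ∈ (φ γ).source → (e α).coordChangeL ℝ (e γ) ((φ α).symm x) = L γ := by
  have h : ∀ γ, ∃ L : Model n ≃L[ℝ] Model n, ∀ᶠ x in 𝓝 (φ α p),
      (φ α).symm x ∈ (φ γ).source → (e α).coordChangeL ℝ (e γ) ((φ α).symm x) = L := by
    intro γ
    by_cases hpγ : p ∈ closure (φ γ).source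
    · obtain ⟨q, -, hq⟩ := he.exists_transition_eq hφ (hr γ) hp hpγ
      exact ⟨_, hq⟩
    · refine ⟨.refl ℝ _, ?_⟩
      have hcont : Tendsto (φ α).symm (𝓝 (φ α p)) (𝓝 p) := (φ α).tendsto_symm hp
      filter_upwards [hcont.eventually (isClosed_closure.isOpen_compl.mem_nhds hpγ)] with x hx hx'
      exact absurd (subset_closure hx') hx
  choose L hL using h
  exact ⟨L, eventually_all.2 hL⟩

end LocalEstimates
end FlatCover

/-! ### The Euler form in the total charts -/

namespace FlatCover

theorem mixedMap_comp {m N : ℕ} (D : Fin N → EuclideanSpace ℝ (Fin m) →L[ℝ] ℝ)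
    (A : Fin N → EuclideanSpace ℝ (Fin m) →L[ℝ] EuclideanSpace ℝ (Fin m))
    (P Q : EuclideanSpace ℝ (Fin m) →L[ℝ] EuclideanSpace ℝ (Fin m))
    (y : EuclideanSpace ℝ (Fin m)) :
    mixedMap (fun γ => (D γ).comp P) (fun γ => (A γ).comp Q) y =
      Q.adjoint.comp ((mixedMap D A (Q y)).comp P) := by
  ext1 u
  simp [mixedMap_apply, ContinuousLinearMap.adjoint_comp, map_sum]

theorem ContinuousLinearMap.det_adjoint_euclideanSpace {m : ℕ}
    (Q : EuclideanSpace ℝ (Fin m) →L[ℝ] EuclideanSpace ℝ (Fin m)) : Q.adjoint.det = Q.det := by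
  have h : (Q.adjoint : EuclideanSpace ℝ (Fin m) →ₗ[ℝ] EuclideanSpace ℝ (Fin m)) =
      LinearMap.adjoint (Q : EuclideanSpace ℝ (Fin m) →ₗ[ℝ] EuclideanSpace ℝ (Fin m)) :=
    (LinearMap.adjoint_eq_toCLM_adjoint _).symm
  rw [ContinuousLinearMap.det, ContinuousLinearMap.det, h,
    ← LinearMap.det_toMatrix (EuclideanSpace.basisFun (Fin m) ℝ).toBasis,
    LinearMap.toMatrix_adjoint, Matrix.det_conjTranspose, star_trivial, LinearMap.det_toMatrix]

theorem ContinuousLinearMap.det_comp {m : ℕ}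
    (P Q : EuclideanSpace ℝ (Fin m) →L[ℝ] EuclideanSpace ℝ (Fin m)) :
    (P.comp Q).det = P.det * Q.det :=
  LinearMap.det_comp _ _

theorem measurableSet_piece {n N : ℕ} {X : Type*} [TopologicalSpace X]
    (Φ : Fin N → OpenPartialHomeomorph X (Model n × Model n)) (α : Fin N) :
    MeasurableSet (piece Φ α) := by
  have h : piece Φ α = (Φ α).target \
      ⋃ β ∈ {β | β < α}, (Φ α).target ∩ (Φ α).symm ⁻¹' (Φ β).source := by
    ext z
    simp only [piece, Set.mem_ofPred_eq, Set.mem_sdiff, Set.mem_iUnion, Set.mem_inter_iff,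
      Set.mem_preimage, not_exists, not_and]
    tauto
  rw [h]
  refine (Φ α).open_target.measurableSet.diff
    (MeasurableSet.biUnion (Set.to_countable _) fun β _ => ?_)
  exact ((Φ α).isOpen_inter_preimage_symm (Φ β).open_source).measurableSet

section Charts

variable {n N : ℕ} {M : Type*} [TopologicalSpace M] [ChartedSpace (Model n) M]
  {φ : Fin N → OpenPartialHomeomorph M (Model n)}
  {F : M → Type*} [TopologicalSpace (TotalSpace (Model n) F)]
  [∀ x, AddCommGroup (F x)] [∀ x, Module ℝ (F x)] [∀ x, TopologicalSpace (F x)]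
  [∀ x, IsTopologicalAddGroup (F x)] [∀ x, ContinuousSMul ℝ (F x)]
  [FiberBundle (Model n) F]
  {nabla : CovariantDerivative (𝓡 (2 * n)) (Model n) F}
  {e : Fin N → Trivialization (Model n) (TotalSpace.proj : TotalSpace (Model n) F → M)}
  [∀ α, (e α).IsLinear ℝ]

theorem IsFlatTrivialization.mem_totalChart_source (he : IsFlatTrivialization nabla φ e)
    {α : Fin N} {v : TotalSpace (Model n) F} :
    v ∈ (totalChart φ e α).source ↔ v.proj ∈ (φ α).source := by
  simp only [totalChart, OpenPartialHomeomorph.trans_source, OpenPartialHomeomorph.prod_source,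
    OpenPartialHomeomorph.refl_source, Set.mem_inter_iff, Set.mem_preimage, Set.mem_prod,
    Set.mem_univ, and_true]
  constructor
  · rintro ⟨h, -⟩
    rw [← he.baseSet_eq]
    exact (e α).mem_source.1 h
  · intro h
    rw [← he.baseSet_eq, ← (e α).mem_source] at h
    refine ⟨h, ?_⟩
    rw [(e α).coe_coe, (e α).coe_fst h, ← he.baseSet_eq]
    exact (e α).mem_source.1 h

theorem IsFlatTrivialization.mem_totalChart_target (he : IsFlatTrivialization nabla φ e)
    {α : Fin N} {z : Model n × Model n} :
    z ∈ (totalChart φ e α).target ↔ z.1 ∈ (φ α).target := by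
  simp only [totalChart, OpenPartialHomeomorph.trans_target, OpenPartialHomeomorph.prod_target,
    OpenPartialHomeomorph.refl_target, Set.mem_inter_iff, Set.mem_preimage, Set.mem_prod,
    Set.mem_univ, and_true]
  refine and_iff_left_of_imp fun h => ?_
  refine (e α).mem_target.2 ?_
  rw [he.baseSet_eq]
  exact (φ α).map_target h

theorem IsFlatTrivialization.proj_totalChart_symm (he : IsFlatTrivialization nabla φ e)
    {α : Fin N} {z : Model n × Model n} (hz : z.1 ∈ (φ α).target) :
    ((totalChart φ e α).symm z).proj = (φ α).symm z.1 := by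
  refine (e α).proj_symm_apply' ?_
  rw [he.baseSet_eq]
  exact (φ α).map_target hz

theorem IsFlatTrivialization.apply_totalChart_symm (he : IsFlatTrivialization nabla φ e)
    {α γ : Fin N} {z : Model n × Model n} (hz : z.1 ∈ (φ α).target)
    (hγ : (φ α).symm z.1 ∈ (φ γ).source) :
    (e γ ((totalChart φ e α).symm z)).2 = (e α).coordChangeL ℝ (e γ) ((φ α).symm z.1) z.2 := by
  have hα := (φ α).map_target hz
  rw [← he.baseSet_eq] at hα hγ
  rw [(e α).coordChangeL_apply' (e γ) ⟨hα, hγ⟩]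
  rfl

/-- The function `|Y|²_T` in a chart, where the transition functions are given by the constants
`L γ ∘ (L α)⁻¹`. -/
theorem IsFlatTrivialization.normSqY_totalChart_symm (he : IsFlatTrivialization nabla φ e)
    {ρ : Fin N → M → ℝ} (hρ : ∀ γ, ∀ x ∉ (φ γ).source, ρ γ x = 0)
    {L : Fin N → Model n ≃L[ℝ] Model n} {α₀ α : Fin N} {T : ℝ} {z : Model n × Model n}
    (hz : z.1 ∈ (φ α).target) (h0 : (φ α).symm z.1 ∈ (φ α₀).source)
    (hL : ∀ γ, (φ α).symm z.1 ∈ (φ γ).source →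
      (e α₀).coordChangeL ℝ (e γ) ((φ α).symm z.1) = L γ) :
    normSqY e ρ T ((totalChart φ e α).symm z) = ∑ γ, ρ γ ((φ α).symm z.1) * T ^ ((γ : ℕ) + 1) *
      ‖((L γ : Model n →L[ℝ] Model n).comp ((L α).symm : Model n →L[ℝ] Model n)) z.2‖ ^ 2 := by
  rw [normSqY]
  refine Finset.sum_congr rfl fun γ _ => ?_
  rw [he.proj_totalChart_symm hz]
  by_cases hγ : (φ α).symm z.1 ∈ (φ γ).source
  · have hα := (φ α).map_target hz
    rw [he.apply_totalChart_symm hz hγ, ← EuclideanSpace.real_norm_sq_eq]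
    congr 3
    have h1 : (e α).coordChangeL ℝ (e γ) ((φ α).symm z.1)
        ((e α₀).coordChangeL ℝ (e α) ((φ α).symm z.1) ((L α).symm z.2)) =
        (e α₀).coordChangeL ℝ (e γ) ((φ α).symm z.1) ((L α).symm z.2) := by
      refine coordChangeL_coordChangeL _ _ _ ?_ ?_ ?_ _ <;> rw [he.baseSet_eq] <;> assumption
    rw [hL α hα, hL γ hγ, ContinuousLinearEquiv.apply_symm_apply] at h1
    rw [h1]
    rfl
  -- Off `U γ` the weight vanishes, so neither the value of `e γ` outside its domain nor the choice
  -- of `L γ` matters.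
  · rw [hρ γ _ hγ, zero_mul, zero_mul, zero_mul]

/-- The Euler form in a chart, at a point near which the transition functions are given by the
constants `L γ ∘ (L α)⁻¹`. -/
theorem IsFlatTrivialization.eulerForm_apply_stdFrame (he : IsFlatTrivialization nabla φ e)
    (hφ : IsOrientedAtlas φ) {ρ : Fin N → M → ℝ}
    (hρs : ∀ γ, ContMDiff (𝓡 (2 * n)) 𝓘(ℝ, ℝ) ∞ (ρ γ))
    (hρ : ∀ γ, ∀ x ∉ (φ γ).source, ρ γ x = 0)
    {L : Fin N → Model n ≃L[ℝ] Model n} {α₀ α : Fin N} {B : Set (Model n)} (hB : IsOpen B)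
    (hL : ∀ x ∈ B, ∀ γ, (φ α₀).symm x ∈ (φ γ).source →
      (e α₀).coordChangeL ℝ (e γ) ((φ α₀).symm x) = L γ)
    {f : M → ℝ} {T : ℝ} {z : Model n × Model n} (hz : z.1 ∈ (φ α).target)
    (h0 : (φ α).symm z.1 ∈ (φ α₀).source) (hzB : φ α₀ ((φ α).symm z.1) ∈ B) :
    eulerForm φ e ρ f T α z (stdFrame n) = f ((φ α).symm z.1) * (frameConst n *
      density (fun γ x => ρ γ ((φ α).symm x))
        (fun γ => (L γ : Model n →L[ℝ] Model n).comp ((L α).symm : Model n →L[ℝ] Model n)) T z) := by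
  have hc : ∀ x ∈ (φ α).target, ∀ γ,
      DifferentiableAt ℝ (fun x => ρ γ ((φ α).symm x)) x := fun x hx γ =>
    (hφ.contDiffAt_comp_symm α hx (hρs γ).contMDiffAt).differentiableAt (by simp)
  have hcT : ∀ x ∈ (φ α).target, ∀ γ,
      HasFDerivAt (fun x => ρ γ ((φ α).symm x) * T ^ ((γ : ℕ) + 1))
        (T ^ ((γ : ℕ) + 1) • fderiv ℝ (fun x => ρ γ ((φ α).symm x)) x) x := fun x hx γ =>
    (hc x hx γ).hasFDerivAt.mul_const _
  have htarget : ∀ᶠ x in 𝓝 z.1, x ∈ (φ α).target := (φ α).open_target.mem_nhds hz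
  have hsymm : ContinuousAt (φ α).symm z.1 := (φ α).continuousAt_symm hz
  have hsource : ∀ᶠ x in 𝓝 z.1, (φ α).symm x ∈ (φ α₀).source :=
    hsymm.eventually ((φ α₀).open_source.mem_nhds h0)
  have hball : ∀ᶠ x in 𝓝 z.1, φ α₀ ((φ α).symm x) ∈ B :=
    (((φ α₀).continuousAt h0).comp hsymm).eventually (hB.mem_nhds hzB)
  have hfst : Tendsto Prod.fst (𝓝 z) (𝓝 z.1) := continuous_fst.continuousAt
  have hG : (fun z => normSqY e ρ T ((totalChart φ e α).symm z)) =ᶠ[𝓝 (z.1, z.2)] fun z =>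
      ∑ γ, ρ γ ((φ α).symm z.1) * T ^ ((γ : ℕ) + 1) *
      ‖((L γ : Model n →L[ℝ] Model n).comp ((L α).symm : Model n →L[ℝ] Model n)) z.2‖ ^ 2 := by
    filter_upwards [hfst.eventually htarget, hfst.eventually hsource, hfst.eventually hball]
      with z' h1 h2 h3
    refine he.normSqY_totalChart_symm hρ h1 h2 fun γ hγ => ?_
    have := hL _ h3 γ
    rw [(φ α₀).left_inv h2] at this
    exact this hγ
  have h := expForm_apply_stdFrame (x := z.1) (y := z.2)
    (c := fun γ x => ρ γ ((φ α).symm x) * T ^ ((γ : ℕ) + 1))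
    (L := fun γ => (L γ : Model n →L[ℝ] Model n).comp ((L α).symm : Model n →L[ℝ] Model n))
    (htarget.mono fun x hx γ => (hcT x hx γ).differentiableAt) hG
  simp only [(hcT _ hz _).fderiv] at h
  rw [eulerForm, AlternatingMap.smul_apply, he.proj_totalChart_symm hz, smul_eq_mul, density]
  congr 1

end Charts
end FlatCover

/-! ### Reduction of all pieces to one chart -/

namespace FlatCover

theorem ContinuousLinearMap.det_prodMap_euclideanSpace {m : ℕ}
    (P Q : EuclideanSpace ℝ (Fin m) →L[ℝ] EuclideanSpace ℝ (Fin m)) :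
    (P.prodMap Q).det = P.det * Q.det :=
  LinearMap.det_prodMap _ _

section ChangeOfVariables

variable {n N : ℕ} {M : Type*} [TopologicalSpace M]
  {φ : Fin N → OpenPartialHomeomorph M (Model n)}

/-- The part of a coordinate domain that corresponds to the piece with index `α`. -/
def basePiece (φ : Fin N → OpenPartialHomeomorph M (Model n)) (B : Set (Model n)) (α₀ α : Fin N) :
    Set (Model n) :=
  {x ∈ B | (φ α₀).symm x ∈ (φ α).source ∧ ∀ β < α, (φ α₀).symm x ∉ (φ β).source}

theorem measurableSet_basePiece {B : Set (Model n)} (hB : IsOpen B) {α₀ : Fin N}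
    (hBt : B ⊆ (φ α₀).target) (α : Fin N) : MeasurableSet (basePiece φ B α₀ α) := by
  have hopen : ∀ β, MeasurableSet (B ∩ (φ α₀).symm ⁻¹' (φ β).source) := fun β =>
    (((φ α₀).continuousOn_symm.mono hBt).isOpen_inter_preimage hB (φ β).open_source).measurableSet
  have h : basePiece φ B α₀ α = (B ∩ (φ α₀).symm ⁻¹' (φ α).source) \
      ⋃ β ∈ {β | β < α}, B ∩ (φ α₀).symm ⁻¹' (φ β).source := by
    ext x
    simp only [basePiece, Set.mem_ofPred_eq, Set.mem_sdiff, Set.mem_iUnion, Set.mem_inter_iff,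
      Set.mem_preimage, not_exists, not_and]
    tauto
  rw [h]
  exact (hopen α).diff (MeasurableSet.biUnion (Set.to_countable _) fun β _ => hopen β)

/-- The change of coordinates between two total charts where the transition function is
constant. -/
noncomputable def totalCoordChange (φ : Fin N → OpenPartialHomeomorph M (Model n))
    (L : Fin N → Model n ≃L[ℝ] Model n) (α₀ α : Fin N) (z : Model n × Model n) :
    Model n × Model n :=
  (φ α ((φ α₀).symm z.1), L α z.2)

theorem injOn_totalCoordChange {B : Set (Model n)} {α₀ : Fin N}
    (hBt : B ⊆ (φ α₀).target) (L : Fin N → Model n ≃L[ℝ] Model n) (α : Fin N) :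
    Set.InjOn (totalCoordChange φ L α₀ α) (basePiece φ B α₀ α ×ˢ Set.univ) := by
  rintro ⟨x, y⟩ ⟨hx, -⟩ ⟨x', y'⟩ ⟨hx', -⟩ h
  obtain ⟨h1, h2⟩ := Prod.ext_iff.1 h
  have h3 := (φ α).injOn hx.2.1 hx'.2.1 h1
  have h4 := (φ α₀).symm.injOn (hBt hx.1) (hBt hx'.1) h3
  exact Prod.ext h4 ((L α).injective h2)

variable [ChartedSpace (Model n) M]

theorem IsOrientedAtlas.contDiffAt_coordChange [IsManifold (𝓡 (2 * n)) ∞ M]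
    (hφ : IsOrientedAtlas φ) (α β : Fin N) {x : Model n}
    (hx : x ∈ (φ α).target) (hxβ : (φ α).symm x ∈ (φ β).source) :
    ContDiffAt ℝ ∞ (φ β ∘ (φ α).symm) x := by
  rw [← contMDiffAt_iff_contDiffAt]
  exact (contMDiffAt_of_mem_maximalAtlas (hφ.smooth β) hxβ).comp x
    ((contMDiffOn_symm_of_mem_maximalAtlas (hφ.smooth α)).contMDiffAt
      ((φ α).open_target.mem_nhds hx))

/-- The transformation of the Euler density under a change of flat coordinates. -/
theorem density_coordChange [IsManifold (𝓡 (2 * n)) ∞ M]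
    (hφ : IsOrientedAtlas φ) {ρ : Fin N → M → ℝ}
    (hρs : ∀ γ, ContMDiff (𝓡 (2 * n)) 𝓘(ℝ, ℝ) ∞ (ρ γ)) (L : Fin N → Model n ≃L[ℝ] Model n)
    {α₀ α : Fin N} (T : ℝ) {x : Model n} (hx : x ∈ (φ α₀).target)
    (hxα : (φ α₀).symm x ∈ (φ α).source) (y : Model n) :
    density (fun γ x => ρ γ ((φ α₀).symm x)) (fun γ => (L γ : Model n →L[ℝ] Model n)) T (x, y) =
      (fderiv ℝ (φ α ∘ (φ α₀).symm) x).det * (L α : Model n →L[ℝ] Model n).det *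
      density (fun γ x => ρ γ ((φ α).symm x))
        (fun γ => (L γ : Model n →L[ℝ] Model n).comp ((L α).symm : Model n →L[ℝ] Model n)) T
        (φ α ((φ α₀).symm x), L α y) := by
  set P := fderiv ℝ (φ α ∘ (φ α₀).symm) x
  have hinv : (φ α).symm (φ α ((φ α₀).symm x)) = (φ α₀).symm x := (φ α).left_inv hxα
  have hP : HasFDerivAt (φ α ∘ (φ α₀).symm) P x :=
    ((hφ.contDiffAt_coordChange α₀ α hx hxα).differentiableAt (by simp)).hasFDerivAt
  have hD : ∀ γ, fderiv ℝ (fun x => ρ γ ((φ α₀).symm x)) x =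
      (fderiv ℝ (fun x => ρ γ ((φ α).symm x)) (φ α ((φ α₀).symm x))).comp P := by
    intro γ
    have h1 : HasFDerivAt (fun x => ρ γ ((φ α).symm x))
        (fderiv ℝ (fun x => ρ γ ((φ α).symm x)) (φ α ((φ α₀).symm x)))
        ((φ α ∘ (φ α₀).symm) x) :=
      ((hφ.contDiffAt_comp_symm α ((φ α).map_source hxα)
        (hρs γ).contMDiffAt).differentiableAt (by simp)).hasFDerivAt
    refine ((h1.comp x hP).congr_of_eventuallyEq ?_).fderiv
    filter_upwards [((φ α₀).continuousAt_symm hx).eventually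
      ((φ α).open_source.mem_nhds hxα)] with u hu
    simp [(φ α).left_inv hu]
  have hA : ∀ γ, (L γ : Model n →L[ℝ] Model n) =
      ((L γ : Model n →L[ℝ] Model n).comp ((L α).symm : Model n →L[ℝ] Model n)).comp
        (L α : Model n →L[ℝ] Model n) := fun γ => by ext1 u; simp
  -- The endomorphism changes by `P` on the right and by the adjoint of `L α` on the left. The
  -- determinant thus gains `det P · det (L α)`, the Jacobian of the change of total coordinates.
  have hmix : mixedMap (fun γ : Fin N => T ^ ((γ : ℕ) + 1) •
        fderiv ℝ (fun x => ρ γ ((φ α₀).symm x)) x) (fun γ => (L γ : Model n →L[ℝ] Model n)) y =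
      (L α : Model n →L[ℝ] Model n).adjoint.comp ((mixedMap (fun γ : Fin N => T ^ ((γ : ℕ) + 1) •
        fderiv ℝ (fun x => ρ γ ((φ α).symm x)) (φ α ((φ α₀).symm x)))
        (fun γ => (L γ : Model n →L[ℝ] Model n).comp ((L α).symm : Model n →L[ℝ] Model n))
        ((L α : Model n →L[ℝ] Model n) y)).comp P) := by
    rw [← mixedMap_comp]
    congr 1
    · funext γ
      rw [hD γ, ContinuousLinearMap.smul_comp]
    · funext γ
      exact hA γ
  simp only [density]
  rw [hmix, ContinuousLinearMap.det_comp, ContinuousLinearMap.det_comp,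
    ContinuousLinearMap.det_adjoint_euclideanSpace]
  simp only [hinv, ContinuousLinearEquiv.coe_coe, ContinuousLinearMap.comp_apply,
    ContinuousLinearEquiv.symm_apply_apply]
  ring

variable
  {F : M → Type*} [TopologicalSpace (TotalSpace (Model n) F)]
  [∀ x, AddCommGroup (F x)] [∀ x, Module ℝ (F x)] [∀ x, TopologicalSpace (F x)]
  [∀ x, IsTopologicalAddGroup (F x)] [∀ x, ContinuousSMul ℝ (F x)]
  [FiberBundle (Model n) F]
  {nabla : CovariantDerivative (𝓡 (2 * n)) (Model n) F}
  {e : Fin N → Trivialization (Model n) (TotalSpace.proj : TotalSpace (Model n) F → M)}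
  [∀ α, (e α).IsLinear ℝ]

/-- The integrals of the Euler form over a piece, in the coordinates of one fixed chart. -/
theorem IsFlatTrivialization.eulerForm_piece [IsManifold (𝓡 (2 * n)) ∞ M]
    (he : IsFlatTrivialization nabla φ e)
    (hφ : IsOrientedAtlas φ) {ρ : Fin N → M → ℝ}
    (hρs : ∀ γ, ContMDiff (𝓡 (2 * n)) 𝓘(ℝ, ℝ) ∞ (ρ γ))
    (hρ : ∀ γ, ∀ x ∉ (φ γ).source, ρ γ x = 0)
    {L : Fin N → Model n ≃L[ℝ] Model n} {α₀ : Fin N} {B : Set (Model n)} (hB : IsOpen B)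
    (hBt : B ⊆ (φ α₀).target)
    (hL : ∀ x ∈ B, ∀ γ, (φ α₀).symm x ∈ (φ γ).source →
      (e α₀).coordChangeL ℝ (e γ) ((φ α₀).symm x) = L γ)
    {f : M → ℝ} (hf : ∀ x, f x ≠ 0 → x ∈ (φ α₀).source ∧ φ α₀ x ∈ B) (T : ℝ) (α : Fin N) :
    ((IntegrableOn (fun z => eulerForm φ e ρ f T α z (stdFrame n)) (piece (totalChart φ e) α)) ↔
      IntegrableOn (fun z => f ((φ α₀).symm z.1) * frameConst n *
        density (fun γ x => ρ γ ((φ α₀).symm x)) (fun γ => (L γ : Model n →L[ℝ] Model n)) T z)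
        (basePiece φ B α₀ α ×ˢ Set.univ)) ∧
    ∫ z in piece (totalChart φ e) α, eulerForm φ e ρ f T α z (stdFrame n) =
      ∫ z in basePiece φ B α₀ α ×ˢ Set.univ, f ((φ α₀).symm z.1) * frameConst n *
        density (fun γ x => ρ γ ((φ α₀).symm x)) (fun γ => (L γ : Model n →L[ℝ] Model n)) T z := by
  set S := basePiece φ B α₀ α ×ˢ (Set.univ : Set (Model n)) with hSdef
  set τ := totalCoordChange φ L α₀ α with hτ
  set τ' : Model n × Model n → (Model n × Model n →L[ℝ] Model n × Model n) := fun z =>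
    (fderiv ℝ (φ α ∘ (φ α₀).symm) z.1).prodMap (L α : Model n →L[ℝ] Model n)
  have hS : MeasurableSet S := (measurableSet_basePiece hB hBt α).prod MeasurableSet.univ
  have hder : ∀ z ∈ S, HasFDerivWithinAt τ (τ' z) S z := by
    rintro z ⟨hz, -⟩
    have h1 := ((hφ.contDiffAt_coordChange α₀ α (hBt hz.1) hz.2.1).differentiableAt
      (by simp)).hasFDerivAt
    have h2 := HasFDerivAt.prodMap z h1 ((L α : Model n →L[ℝ] Model n).hasFDerivAt (x := z.2))
    exact h2.hasFDerivWithinAt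
  have hinj : Set.InjOn τ S := injOn_totalCoordChange hBt L α
  have hproj : ∀ z ∈ S, (φ α).symm (τ z).1 = (φ α₀).symm z.1 := fun z hz =>
    (φ α).left_inv hz.1.2.1
  have htgt : ∀ z ∈ S, (τ z).1 ∈ (φ α).target := fun z hz => (φ α).map_source hz.1.2.1
  have hpull : ∀ z ∈ S, |(τ' z).det| • eulerForm φ e ρ f T α (τ z) (stdFrame n) =
      f ((φ α₀).symm z.1) * frameConst n * density (fun γ x => ρ γ ((φ α₀).symm x))
        (fun γ => (L γ : Model n →L[ℝ] Model n)) T z := by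
    intro z hz
    have hz0 := (φ α₀).map_target (hBt hz.1.1)
    -- Here the orientations of `M` and `F` enter: the change of variables formula has the absolute
    -- value of the Jacobian, the form the Jacobian itself.
    have hpos : 0 < (τ' z).det := by
      rw [ContinuousLinearMap.det_prodMap_euclideanSpace]
      refine mul_pos ?_ ?_
      · have := hφ.pos α₀ α _ hz0 hz.1.2.1
        rwa [(φ α₀).right_inv (hBt hz.1.1)] at this
      · have := he.pos α₀ α _ hz0 hz.1.2.1
        rwa [hL _ hz.1.1 α hz.1.2.1] at this
    rw [abs_of_pos hpos, he.eulerForm_apply_stdFrame hφ hρs hρ hB hL (htgt z hz)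
      (by rw [hproj z hz]; exact hz0)
      (by rw [hproj z hz, (φ α₀).right_inv (hBt hz.1.1)]; exact hz.1.1), hproj z hz,
      density_coordChange hφ hρs L T (hBt hz.1.1) hz.1.2.1,
      ContinuousLinearMap.det_prodMap_euclideanSpace, smul_eq_mul]
    simp only [hτ, totalCoordChange]
    ring
  have hsub : τ '' S ⊆ piece (totalChart φ e) α := by
    rintro _ ⟨z, hz, rfl⟩
    refine ⟨he.mem_totalChart_target.2 (htgt z hz), fun β hβ h => ?_⟩
    rw [he.mem_totalChart_source, he.proj_totalChart_symm (htgt z hz), hproj z hz] at h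
    exact hz.1.2.2 β hβ h
  -- Points of the piece not reached from `B` lie outside the support of `f`.
  have hzero : ∀ z ∈ piece (totalChart φ e) α \ τ '' S,
      eulerForm φ e ρ f T α z (stdFrame n) = 0 := by
    rintro z ⟨⟨hz, hzβ⟩, hzS⟩
    have hzt := he.mem_totalChart_target.1 hz
    by_contra hne
    have hfz : f ((φ α).symm z.1) ≠ 0 := by
      intro h0
      rw [eulerForm, AlternatingMap.smul_apply, he.proj_totalChart_symm hzt, h0, zero_smul] at hne
      exact hne rfl
    obtain ⟨h1, h2⟩ := hf _ hfz
    have h3 := (φ α₀).left_inv h1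
    refine hzS ⟨(φ α₀ ((φ α).symm z.1), (L α).symm z.2), ⟨⟨h2, ?_, fun β hβ h => ?_⟩, trivial⟩, ?_⟩
    · change (φ α₀).symm (φ α₀ ((φ α).symm z.1)) ∈ _
      rw [h3]
      exact (φ α).map_target hzt
    · change (φ α₀).symm (φ α₀ ((φ α).symm z.1)) ∈ _ at h
      rw [h3] at h
      refine hzβ β hβ ?_
      rwa [he.mem_totalChart_source, he.proj_totalChart_symm hzt]
    · simp only [hτ, totalCoordChange, h3, (φ α).right_inv hzt,
        ContinuousLinearEquiv.apply_symm_apply]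
  have hHaar : (volume : Measure (Model n × Model n)).IsAddHaarMeasure :=
    Measure.prod.instIsAddHaarMeasure volume volume
  have hpm := measurableSet_piece (totalChart φ e) α
  constructor
  · have h1 : IntegrableOn (fun z => eulerForm φ e ρ f T α z (stdFrame n))
        (piece (totalChart φ e) α) ↔
        IntegrableOn (fun z => eulerForm φ e ρ f T α z (stdFrame n)) (τ '' S) :=
      ⟨fun h => h.mono_set hsub, fun h => h.of_forall_sdiff_eq_zero hpm hzero⟩
    rw [h1, integrableOn_image_iff_integrableOn_abs_det_fderiv_smul volume hS hder hinj]
    exact integrableOn_congr_fun hpull hS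
  · rw [setIntegral_eq_of_subset_of_forall_sdiff_eq_zero hpm hsub hzero,
      integral_image_eq_integral_abs_det_fderiv_smul volume hS hder hinj]
    exact setIntegral_congr_fun hS hpull

end ChangeOfVariables
end FlatCover

/-! ### The vanishing theorem away from the positive vertices -/

theorem propositiont3p2 {n N : ℕ}
    {M : Type*} [TopologicalSpace M] [ChartedSpace (FlatCover.Model n) M]
    [IsManifold (𝓡 (2 * n)) ∞ M] [CompactSpace M] [T2Space M]
    {F : M → Type*} [TopologicalSpace (TotalSpace (FlatCover.Model n) F)]
    [∀ x, AddCommGroup (F x)] [∀ x, Module ℝ (F x)] [∀ x, TopologicalSpace (F x)]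
    [∀ x, IsTopologicalAddGroup (F x)] [∀ x, ContinuousSMul ℝ (F x)]
    [FiberBundle (FlatCover.Model n) F] [VectorBundle ℝ (FlatCover.Model n) F]
    [ContMDiffVectorBundle ∞ (FlatCover.Model n) F (𝓡 (2 * n))]
    (nabla : CovariantDerivative (𝓡 (2 * n)) (FlatCover.Model n) F)
    (φ : Fin N → OpenPartialHomeomorph M (FlatCover.Model n))
    (hφ : FlatCover.IsOrientedAtlas φ)
    (e : Fin N → Trivialization (FlatCover.Model n)
      (TotalSpace.proj : TotalSpace (FlatCover.Model n) F → M))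
    [∀ α, (e α).IsLinear ℝ]
    (he : FlatCover.IsFlatTrivialization nabla φ e)
    (hU : FlatCover.IsTransversalFamily (n := n) (fun α => (φ α).source))
    (g : ContMDiffRiemannianMetric (𝓡 (2 * n)) ∞ (FlatCover.Model n)
      (fun x : M => TangentSpace (𝓡 (2 * n)) x))
    (r : Fin N → M → ℝ)
    (hr : ∀ α, FlatCover.IsNormalGeodesicCoordinate g (φ α).source (r α))
    (ρ : Fin N → M → ℝ)
    (hρ : ∀ α, FlatCover.IsWeight (n := n) (φ α).source (r α) (ρ α))
    (p : M) (hp : p ∉ FlatCover.positiveVertices (2 * n) (fun α => (φ α).source)) :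
    ∃ V : Set M, IsOpen V ∧ p ∈ V ∧
      ∀ f : M → ℝ, ContMDiff (𝓡 (2 * n)) 𝓘(ℝ, ℝ) ∞ f → tsupport f ⊆ V →
        (∀ T : ℝ, 0 < T → FlatCover.FormIntegrable (FlatCover.totalChart φ e)
          (FlatCover.eulerForm φ e ρ f T)) ∧
        Tendsto (fun T : ℝ => FlatCover.formIntegral (FlatCover.totalChart φ e)
          (FlatCover.eulerForm φ e ρ f T)) atTop (𝓝 0) := by
  classical
  have hopen : ∀ γ, IsOpen (φ γ).source := fun γ => (φ γ).open_source
  obtain ⟨a, ha, hamax⟩ : ∃ a, p ∈ (φ a).source ∧ ∀ γ, p ∈ (φ γ).source → γ ≤ a := by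
    obtain ⟨α, hα⟩ := hφ.covers p
    obtain ⟨a, ha, hmax⟩ := Finset.exists_max_image
      (Finset.univ.filter fun γ => p ∈ (φ γ).source) id ⟨α, by simpa using hα⟩
    exact ⟨a, by simpa using ha, fun γ hγ => hmax γ (by simpa using hγ)⟩
  set J : Finset (Fin N) := Finset.univ.filter fun γ => a < γ ∧ p ∈ frontier (φ γ).source with hJdef
  have hJa : ∀ γ ∈ J, a < γ := fun γ hγ => (Finset.mem_filter.1 hγ).2.1
  have hJf : ∀ γ ∈ J, p ∈ frontier (φ γ).source := fun γ hγ => (Finset.mem_filter.1 hγ).2.2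
  -- If `J` had `2n` elements, it would contain every index whose boundary passes through `p`. All
  -- these exceed `a`, hence every index of a set containing `p`, and `p` would lie in `B₊`.
  have hJm : J.card < 2 * n := by
    by_contra! hcard
    have hle := FlatCover.ncard_frontier_le hU hr p
    have hsub : (J : Set (Fin N)) ⊆ {α | p ∈ frontier (φ α).source} := fun γ hγ => hJf γ hγ
    have hfin : {α | p ∈ frontier (φ α).source}.Finite := Set.toFinite _
    rw [← Set.ncard_coe_finset] at hcard
    have heq := Set.eq_of_subset_of_ncard_le hsub (hle.trans hcard) hfin
    refine hp ⟨le_antisymm hle (hcard.trans (Set.ncard_le_ncard hsub hfin)), fun α β hα hβ => ?_⟩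
    have hβJ : β ∈ (J : Set (Fin N)) := by rw [heq]; exact hβ
    exact (hamax α hα).trans_lt (hJa β hβJ)
  have hnN : 0 < n * N := Nat.mul_pos (by omega) (Fin.pos a)
  -- The exponent `2mN` with `m = 2n` in the even form required by the weight estimate; it is
  -- positive as `n` and `N` are.
  obtain ⟨j, hj⟩ : ∃ j, 2 * (2 * n) * N = 2 * j + 2 := ⟨2 * (n * N) - 1, by
    have : 2 * (2 * n) * N = 4 * (n * N) := by ring
    omega⟩
  obtain ⟨L, hL⟩ := he.exists_eventually_transition_eq hφ hr ha
  obtain ⟨c₀, hc₀, hqa⟩ := (hρ a).exists_pos_eventually_le ha ha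
  obtain ⟨K₀, hK₀, hqK⟩ := ((eventually_ge_atTop (0 : ℝ)).and
    (eventually_all.2 fun γ => (hρ γ).eventually_le hφ ha)).exists
  obtain ⟨K₁, hK₁, hqJ⟩ := ((eventually_ge_atTop (1 : ℝ)).and
    ((Filter.eventually_all_finset J).2 fun γ hγ =>
      (hρ γ).eventually_norm_fderiv_pow_le (hopen γ) (hr γ) hφ ha (hJf γ hγ) j)).exists
  obtain ⟨κ, hκL, hκ⟩ := ((eventually_all.2 fun γ =>
    FlatCover.ContinuousLinearEquiv.eventually_mul_norm_le (L γ)).and self_mem_nhdsWithin).exists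
  have hz : ∀ᶠ x in 𝓝 (φ a p), ∀ γ, a < γ → γ ∉ J → ρ γ ((φ a).symm x) = 0 ∧
      fderiv ℝ (fun x => ρ γ ((φ a).symm x)) x = 0 := by
    refine eventually_all.2 fun γ => ?_
    by_cases hγ : a < γ ∧ γ ∉ J
    · refine ((hρ γ).eventually_eq_zero ha fun hc => ?_).mono fun x hx _ _ => hx
      -- By maximality of `a`, `p ∉ U γ`; so if `p` were in the closure it would be on the boundary,
      -- and `γ` would belong to `J`.
      refine hγ.2 (Finset.mem_filter.2 ⟨Finset.mem_univ _, hγ.1, hc, ?_⟩)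
      rw [(hopen γ).interior_eq]
      exact fun h => hγ.1.not_ge (hamax γ h)
    · exact Eventually.of_forall fun x h1 h2 => absurd ⟨h1, h2⟩ hγ
  have htarget : ∀ᶠ x in 𝓝 (φ a p), x ∈ (φ a).target :=
    (φ a).open_target.mem_nhds ((φ a).map_source ha)
  -- One ball on which all local statements hold, so that the constants are uniform in the base
  -- point.
  obtain ⟨δ, hδ, hball⟩ := Metric.eventually_nhds_iff_ball.1 (htarget.and (hL.and (hqa.and
    ((eventually_all.2 hqK).and (((Filter.eventually_all_finset J).2 hqJ).and hz)))))
  set B := Metric.ball (φ a p) δ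
  have hB : IsOpen B := Metric.isOpen_ball
  have hBt : B ⊆ (φ a).target := fun x hx => (hball x hx).1
  refine ⟨(φ a).source ∩ φ a ⁻¹' B, (φ a).isOpen_inter_preimage hB,
    ⟨ha, Metric.mem_ball_self hδ⟩, fun f hf hfV => ?_⟩
  obtain ⟨C, hC⟩ : ∃ C, ∀ x, ‖f x‖ ≤ C := by
    obtain ⟨C, hC⟩ := isCompact_univ.exists_bound_of_continuousOn hf.continuous.continuousOn
    exact ⟨C, fun x => hC x trivial⟩
  have hpiece := fun T α => he.eulerForm_piece hφ (fun γ => (hρ γ).smooth)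
    (fun γ x hx => (hρ γ).eq_zero_of_notMem (hopen γ) (hr γ) hx) hB hBt
    (fun x hx => (hball x hx).2.1) (f := f) (fun x hx => hfV (subset_tsupport f hx)) T α
  have hq : ∀ γ, ContDiffOn ℝ 1 (fun x => ρ γ ((φ a).symm x)) B := fun γ =>
    ((hφ.contDiffOn_comp_symm a (hρ γ).smooth).mono hBt).of_le (by simp)
  have hS := fun α => FlatCover.measurableSet_basePiece hB hBt α
  have hSB : ∀ α, FlatCover.basePiece φ B a α ⊆ B := fun α x hx => hx.1
  have hvol : ∀ α, volume (FlatCover.basePiece φ B a α) < ⊤ := fun α =>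
    (measure_mono (hSB α)).trans_lt measure_ball_lt_top
  have hF : ContinuousOn (fun x => f ((φ a).symm x) * FlatCover.frameConst n) B :=
    ((hφ.contDiffOn_comp_symm a hf).continuousOn.mono hBt).mul continuousOn_const
  have hFM : ∀ x ∈ B, |f ((φ a).symm x) * FlatCover.frameConst n| ≤ C * |FlatCover.frameConst n| :=
    fun x _ => by
      rw [abs_mul]
      exact mul_le_mul_of_nonneg_right (hC _) (abs_nonneg _)
  have hq0 : ∀ x ∈ B, ∀ γ, 0 ≤ ρ γ ((φ a).symm x) := fun x _ γ =>
    (hρ γ).nonneg (hopen γ) (hr γ) _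
  have hqJ' : ∀ x ∈ B, ∀ γ ∈ J, ‖fderiv ℝ (fun x => ρ γ ((φ a).symm x)) x‖ ^ (2 * (2 * n) * N) ≤
      K₁ * ρ γ ((φ a).symm x) ^ (2 * (2 * n) * N - 1) := by
    rw [hj]
    exact fun x hx => (hball x hx).2.2.2.2.1
  constructor
  · intro T hT α
    exact (hpiece T α).1.2 (FlatCover.integrableOn_mul_density hB hq (hS α) (hSB α) (hvol α) hF hFM
      hT hκ (hκL a) hq0 (fun x hx γ => ((hball x hx).2.2.2.1 γ).2)
      (fun x hx => (hball x hx).2.2.1) hc₀)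
  · have hlim : ∀ α, Tendsto (fun T : ℝ => ∫ z in FlatCover.piece (FlatCover.totalChart φ e) α,
        FlatCover.eulerForm φ e ρ f T α z (FlatCover.stdFrame n)) atTop (𝓝 0) := fun α => by
      have h := FlatCover.tendsto_setIntegral_mul_density
        (q := fun γ x => ρ γ ((φ a).symm x))
        (L := fun γ => (L γ : FlatCover.Model n →L[ℝ] FlatCover.Model n))
        hB hq (hS α) (hSB α) (hvol α) hF hFM J hJa
        hJm hκ hκL hq0 (fun x hx γ => ((hball x hx).2.2.2.1 γ).1)
        (fun x hx γ => ((hball x hx).2.2.2.1 γ).2) (fun x hx => (hball x hx).2.2.1) hc₀ hK₀ hK₁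
        hqJ' (fun x hx => (hball x hx).2.2.2.2.2)
      exact h.congr fun T => ((hpiece T α).2).symm
    simpa [FlatCover.formIntegral] using tendsto_finsetSum Finset.univ fun α _ => hlim α
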